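/- Let $C$ be an algebraically closed field of characteristic zero, let $K=C(x)$ with the derivation $d/dx$, and let $K[D]$ be the ring of linear differential operators with coefficients in $K$ (so $Da=aD+a'$ for $a\in K$). A Puiseux series at $\xi\in C\cup\{\infty\}$ is a Laurent series in $t^{1/q}$ with coefficients in $C$, for some integer $q\ge 1$, where $t=x-\xi$ if $\xi\in C$ and $t=1/x$ if $\xi=\infty$; it is called integral if it contains no negative power of $t$. For $L\in K[D]$, an element $[P]_L$ of the left module $K[D]/\langle L\rangle$, where $\langle L\rangle=K[D]L$, is called completely integral if for every $\xi\in C\cup\{\infty\}$ and every Puiseux series solution $f$ of $L$ at $\xi$ the series $P\cdot f$ is integral. It is called a pseudoconstant of $L$ if it is completely integral and $D\cdot[P]_L\ne[0]_L$. The symmetric product $L\otimes M$ of nonzero operators $L,M\in K[D]$ is the unique monic operator of lowest order which annihilates $fg$ whenever $f$ is a solution of $L$ and $g$ is a solution of $M$ in a common differential extension field of $K$. The symmetric powers are $L^{\otimes 1}=L$ and $L^{\otimes (s+1)}=L^{\otimes s}\otimes L$ for $s\ge1$. **Theorem.** Let $L\in K[D]$ be an operator which at every point $\xi\in C\cup\{\infty\}$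 has a basis of $\operatorname{ord}(L)$ Puiseux series solutions over $C$. Suppose that for some integer $s\ge 1$ the symmetric power $L^{\otimes s}$ has a pseudoconstant. Then $L$ has at least one transcendental solution. More precisely: there is no differential field $E$, finite over $K$, in which the solution space of $L$ has dimension $\operatorname{ord}(L)$ over $C$; and for every $\xi\in C\cup\{\infty\}$ at least one Puiseux series solution of $L$ at $\xi$ is transcendental over $K$. -/

import Mathlib

open Polynomial
open scoped Differential

universe u

/-! ### The ring `K[D]` of linear differential operators over a differential field `K` -/

/-- `K[D]`: the operator `p₀ + p₁ D + ⋯ + p_r D ^ r` is stored as the polynomial with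
coefficients `p₀, …, p_r`.  Only the additive structure is that of polynomials; the product
is the one with `D * a = a * D + a′`. -/
@[ext]
structure DiffOp (K : Type*) [Field K] where
  /-- The polynomial with the same coefficients. -/
  toPoly : K[X]

namespace DiffOp

section PolyAct

variable {K : Type*} [Field K] {M : Type*} [AddCommGroup M] [Module K M]

/-- `p₀ m + p₁ δ m + ⋯ + p_r δ ^ r m`, for an additive endomorphism `δ` of a vector space. -/
noncomputable def act (δ : M →+ M) (P : K[X]) (m : M) : M :=
  P.sum fun i a => a • (δ^[i] m)

theorem act_add (δ : M →+ M) (P Q : K[X]) (m : M) : act δ (P + Q) m = act δ P m + act δ Q m :=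
  Polynomial.sum_add_index P Q _ (by simp) (by simp [add_smul])

theorem act_zero (δ : M →+ M) (m : M) : act δ (0 : K[X]) m = 0 :=
  Polynomial.sum_zero_index _

theorem act_apply_add (δ : M →+ M) (P : K[X]) (m n : M) :
    act δ P (m + n) = act δ P m + act δ P n := by
  simp only [act, Polynomial.sum, ← Finset.sum_add_distrib, ← smul_add]
  refine Finset.sum_congr rfl fun i _ => ?_
  rw [iterate_map_add]

theorem act_apply_zero (δ : M →+ M) (P : K[X]) : act δ P (0 : M) = 0 := by
  simp only [act, Polynomial.sum]
  refine Finset.sum_eq_zero fun i _ => ?_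
  rw [iterate_map_zero, smul_zero]

theorem act_monomial (δ : M →+ M) (i : ℕ) (a : K) (m : M) :
    act δ (monomial i a) m = a • (δ^[i] m) :=
  Polynomial.sum_monomial_index a _ (by simp)

theorem act_smul (δ : M →+ M) (a : K) (P : K[X]) (m : M) : act δ (a • P) m = a • act δ P m := by
  rw [act, act, Polynomial.sum_smul_index _ _ _ (by simp), Polynomial.sum, Polynomial.sum,
    Finset.smul_sum]
  simp [mul_smul]

variable [Differential K]

/-- Left multiplication by `D`: `D * ∑ aᵢ D ^ i = ∑ aᵢ D ^ (i + 1) + ∑ aᵢ′ D ^ i`. -/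
noncomputable def leftD : K[X] →+ K[X] :=
  AddMonoidHom.mulLeft (X : K[X]) + (Differential.mapCoeffs : Derivation ℤ K[X] K[X])

theorem leftD_monomial (i : ℕ) (a : K) :
    leftD (monomial i a) = monomial (i + 1) a + monomial i a′ := by
  simp [leftD, X_mul_monomial]

theorem leftD_smul (a : K) (m : K[X]) : leftD (a • m) = a′ • m + a • leftD m := by
  simp only [leftD, AddMonoidHom.add_apply, AddMonoidHom.coe_mulLeft, smul_eq_C_mul]
  simp
  ring

theorem act_leftD (δ : M →+ M) (hδ : ∀ (a : K) (m : M), δ (a • m) = a′ • m + a • δ m)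
    (Q : K[X]) (m : M) : act δ (leftD Q) m = δ (act δ Q m) := by
  induction Q using Polynomial.induction_on' with
  | add P Q hP hQ => rw [map_add, act_add, act_add, hP, hQ, map_add]
  | monomial i a =>
    rw [leftD_monomial, act_add, act_monomial, act_monomial, act_monomial, hδ,
      Function.iterate_succ_apply', add_comm]

theorem act_act (δ : M →+ M) (hδ : ∀ (a : K) (m : M), δ (a • m) = a′ • m + a • δ m)
    (P Q : K[X]) (m : M) : act δ (act leftD P Q) m = act δ P (act δ Q m) := by
  induction P using Polynomial.induction_on' with
  | add P P' hP hP' => rw [act_add, act_add, act_add, hP, hP']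
  | monomial i a =>
    have h : ∀ i : ℕ, act δ (leftD^[i] Q) m = δ^[i] (act δ Q m) := by
      intro i
      induction i with
      | zero => rfl
      | succ i ih =>
        rw [Function.iterate_succ_apply', Function.iterate_succ_apply', ← ih, act_leftD δ hδ]
    rw [act_monomial, act_monomial, act_smul, h]

theorem leftD_iterate_one (i : ℕ) : leftD^[i] (1 : K[X]) = monomial i 1 := by
  induction i with
  | zero => rfl
  | succ i ih => rw [Function.iterate_succ_apply', ih, leftD_monomial]; simp

end PolyAct

section Ring

variable {K : Type*} [Field K]

/-- The order of a nonzero operator (and `0` for the zero operator). -/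
noncomputable def ord (P : DiffOp K) : ℕ := P.toPoly.natDegree

/-- The operator is monic: the coefficient of the highest power of `D` is `1`. -/
def Monic (P : DiffOp K) : Prop := P.toPoly.Monic

/-- The operator `D`. -/
noncomputable def D : DiffOp K := ⟨X⟩

/-- The operator of order zero given by multiplication with `a`. -/
noncomputable def const (a : K) : DiffOp K := ⟨C a⟩

/-- The coefficient bijection, used to transport the additive structure. -/
def polyEquiv : DiffOp K ≃ K[X] where
  toFun := toPoly
  invFun := mk
  left_inv _ := rfl
  right_inv _ := rfl

noncomputable instance : AddCommGroup (DiffOp K) := polyEquiv.addCommGroup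

theorem toPoly_add (P Q : DiffOp K) : (P + Q).toPoly = P.toPoly + Q.toPoly := rfl

theorem toPoly_zero : (0 : DiffOp K).toPoly = 0 := rfl

noncomputable instance : One (DiffOp K) := ⟨⟨1⟩⟩

theorem toPoly_one : (1 : DiffOp K).toPoly = 1 := rfl

variable [Differential K]

noncomputable instance : Mul (DiffOp K) := ⟨fun P Q => ⟨act leftD P.toPoly Q.toPoly⟩⟩

theorem toPoly_mul (P Q : DiffOp K) : (P * Q).toPoly = act leftD P.toPoly Q.toPoly := rfl

theorem mul_assoc_aux (P Q R : DiffOp K) : P * Q * R = P * (Q * R) := by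
  ext1
  simp only [toPoly_mul]
  exact act_act (K := K) (M := K[X]) leftD (fun a m => leftD_smul a m) P.toPoly Q.toPoly R.toPoly

theorem one_mul_aux (P : DiffOp K) : 1 * P = P := by
  ext1
  rw [toPoly_mul, toPoly_one, ← monomial_zero_one, act_monomial, one_smul]
  rfl

theorem mul_one_aux (P : DiffOp K) : P * 1 = P := by
  ext1
  rw [toPoly_mul, toPoly_one, act]
  simp only [leftD_iterate_one, smul_monomial, smul_eq_mul, mul_one]
  exact P.toPoly.sum_monomial_eq

theorem mul_add_aux (P Q R : DiffOp K) : P * (Q + R) = P * Q + P * R := by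
  ext1
  simp only [toPoly_mul, toPoly_add, act_apply_add]

theorem add_mul_aux (P Q R : DiffOp K) : (P + Q) * R = P * R + Q * R := by
  ext1
  simp only [toPoly_mul, toPoly_add, act_add]

noncomputable instance : Ring (DiffOp K) :=
  { (inferInstance : AddCommGroup (DiffOp K)) with
    mul := (· * ·)
    one := 1
    mul_assoc := mul_assoc_aux
    one_mul := one_mul_aux
    mul_one := mul_one_aux
    left_distrib := mul_add_aux
    right_distrib := add_mul_aux
    zero_mul := fun (P : DiffOp K) => DiffOp.ext (act_zero (K := K) leftD P.toPoly)
    mul_zero := fun (P : DiffOp K) => DiffOp.ext (act_apply_zero (K := K) leftD P.toPoly) }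

/-- The Leibniz rule in `K[D]`. -/
theorem D_mul_const (a : K) : D * const a = const a * D + const a′ := by
  ext1
  rw [toPoly_add, toPoly_mul, toPoly_mul]
  simp only [D, const, ← monomial_one_one_eq_X, ← monomial_zero_left]
  rw [act_monomial, act_monomial, one_smul, Function.iterate_one, Function.iterate_zero_apply,
    leftD_monomial, smul_monomial, smul_eq_mul, mul_one]

theorem toPoly_const_mul (a : K) (P : DiffOp K) : (const a * P).toPoly = a • P.toPoly := by
  rw [toPoly_mul, const, ← monomial_zero_left, act_monomial, Function.iterate_zero_apply]

theorem mul_const_of_deriv_eq_zero (P : DiffOp K) (a : K) (ha : a′ = 0) :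
    P * const a = const a * P := by
  ext1
  rw [toPoly_const_mul, toPoly_mul, act, const]
  have h : ∀ i : ℕ, leftD^[i] (C a : K[X]) = monomial i a := by
    intro i
    induction i with
    | zero => rfl
    | succ i ih => rw [Function.iterate_succ_apply', ih, leftD_monomial, ha]; simp
  simp only [h, smul_monomial, smul_eq_mul]
  conv_rhs => rw [← P.toPoly.sum_monomial_eq, Polynomial.sum, Finset.smul_sum]
  simp only [Polynomial.sum, smul_monomial, smul_eq_mul, mul_comm a]

end Ring

/-! ### The action of `K[D]` on differential extensions of `K` -/

section Action

variable {K : Type*} [Field K] [Differential K]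
variable {F : Type*} [CommRing F] [Algebra K F] [Differential F] [DifferentialAlgebra K F]

theorem deriv_smul (a : K) (f : F) : (a • f)′ = a′ • f + a • f′ := by
  rw [Algebra.smul_def, Derivation.leibniz, deriv_algebraMap]
  simp [Algebra.smul_def]
  ring

/-- The derivation of `F` as an additive map. -/
noncomputable def derivHom (F : Type*) [CommRing F] [Differential F] : F →+ F :=
  (Differential.deriv : Derivation ℤ F F).toLinearMap.toAddMonoidHom

theorem derivHom_apply (f : F) : derivHom F f = f′ := rfl

/-- The action `(p₀ + p₁ D + ⋯ + p_r D ^ r) • f = p₀ f + p₁ f′ + ⋯ + p_r f ^ (r)`. -/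
noncomputable instance instModule : Module (DiffOp K) F where
  smul P f := act (derivHom F) P.toPoly f
  one_smul f := by
    change act (derivHom F) (1 : K[X]) f = f
    rw [← monomial_zero_one, act_monomial, one_smul, Function.iterate_zero_apply]
  mul_smul P Q f :=
    act_act (derivHom F) (fun (a : K) (m : F) => by
      simp only [derivHom_apply]; exact deriv_smul a m) P.toPoly Q.toPoly f
  smul_zero P := act_apply_zero (derivHom F) P.toPoly
  smul_add P f g := act_apply_add (derivHom F) P.toPoly f g
  add_smul P Q f := act_add (derivHom F) P.toPoly Q.toPoly f
  zero_smul f := act_zero (K := K) (derivHom F) f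

theorem smul_def (P : DiffOp K) (f : F) : P • f = act (derivHom F) P.toPoly f := rfl

theorem D_smul (f : F) : (D : DiffOp K) • f = f′ := by
  rw [smul_def, D, ← monomial_one_one_eq_X, act_monomial, one_smul]
  rfl

theorem const_smul (a : K) (f : F) : (const a : DiffOp K) • f = a • f := by
  rw [smul_def, const, ← monomial_zero_left, act_monomial, Function.iterate_zero_apply]

end Action

end DiffOp

/-- A derivation from an additive map that satisfies the Leibniz rule. -/
@[reducible]
def differentialOfLeibniz {R : Type*} [CommRing R] (d : R → R)
    (add : ∀ f g, d (f + g) = d f + d g) (mul : ∀ f g, d (f * g) = f * d g + g * d f) :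
    Differential R :=
  ⟨Derivation.mk' (AddMonoidHom.mk' d add).toIntLinearMap mul⟩

/-! ### The differential field `C(x)` -/

section RatFuncDeriv

variable {C : Type u} [Field C]

/-- The derivative `(p / q)′ = (p′ q - p q′) / q ^ 2` of a rational function. -/
noncomputable def ratDeriv (f : RatFunc C) : RatFunc C :=
  (algebraMap C[X] (RatFunc C) (derivative f.num) * algebraMap C[X] (RatFunc C) f.denom
    - algebraMap C[X] (RatFunc C) f.num * algebraMap C[X] (RatFunc C) (derivative f.denom))
    / algebraMap C[X] (RatFunc C) f.denom ^ 2

theorem ratDeriv_div (p q : C[X]) (hq : q ≠ 0) :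
    ratDeriv (algebraMap C[X] (RatFunc C) p / algebraMap C[X] (RatFunc C) q) =
      (algebraMap C[X] (RatFunc C) (derivative p) * algebraMap C[X] (RatFunc C) q
        - algebraMap C[X] (RatFunc C) p * algebraMap C[X] (RatFunc C) (derivative q))
        / algebraMap C[X] (RatFunc C) q ^ 2 := by
  set f := algebraMap C[X] (RatFunc C) p / algebraMap C[X] (RatFunc C) q with hf
  have hq' : algebraMap C[X] (RatFunc C) q ≠ 0 := RatFunc.algebraMap_ne_zero hq
  have hd' : algebraMap C[X] (RatFunc C) f.denom ≠ 0 :=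
    RatFunc.algebraMap_ne_zero f.denom_ne_zero
  have h0 : algebraMap C[X] (RatFunc C) f.num * algebraMap C[X] (RatFunc C) q
      = algebraMap C[X] (RatFunc C) p * algebraMap C[X] (RatFunc C) f.denom := by
    rw [← div_eq_div_iff hd' hq', RatFunc.num_div_denom]
  have h1 : f.num * q = p * f.denom := by
    apply RatFunc.algebraMap_injective C
    rw [map_mul, map_mul, h0]
  have h2 := congrArg (fun g => algebraMap C[X] (RatFunc C) (derivative g)) h1
  simp only [derivative_mul, map_add, map_mul] at h2
  rw [ratDeriv, div_eq_div_iff (pow_ne_zero 2 hd') (pow_ne_zero 2 hq')]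
  linear_combination (algebraMap C[X] (RatFunc C) q * algebraMap C[X] (RatFunc C) f.denom) * h2
    - (algebraMap C[X] (RatFunc C) (derivative q) * algebraMap C[X] (RatFunc C) f.denom
      + algebraMap C[X] (RatFunc C) q * algebraMap C[X] (RatFunc C) (derivative f.denom)) * h0

theorem ratDeriv_add (f g : RatFunc C) : ratDeriv (f + g) = ratDeriv f + ratDeriv g := by
  induction f using RatFunc.induction_on with | f p q hq
  induction g using RatFunc.induction_on with | f r s hs
  have hq' : algebraMap C[X] (RatFunc C) q ≠ 0 := RatFunc.algebraMap_ne_zero hq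
  have hs' : algebraMap C[X] (RatFunc C) s ≠ 0 := RatFunc.algebraMap_ne_zero hs
  have h := ratDeriv_div (p * s + q * r) (q * s) (mul_ne_zero hq hs)
  rw [map_add, map_mul, map_mul, map_mul] at h
  rw [div_add_div _ _ hq' hs', h, ratDeriv_div p q hq, ratDeriv_div r s hs]
  simp only [derivative_mul, map_add, map_mul]
  field_simp
  ring

theorem ratDeriv_mul (f g : RatFunc C) :
    ratDeriv (f * g) = f * ratDeriv g + g * ratDeriv f := by
  induction f using RatFunc.induction_on with | f p q hq
  induction g using RatFunc.induction_on with | f r s hs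
  have hq' : algebraMap C[X] (RatFunc C) q ≠ 0 := RatFunc.algebraMap_ne_zero hq
  have hs' : algebraMap C[X] (RatFunc C) s ≠ 0 := RatFunc.algebraMap_ne_zero hs
  have h := ratDeriv_div (p * r) (q * s) (mul_ne_zero hq hs)
  rw [map_mul, map_mul] at h
  rw [div_mul_div_comm, h, ratDeriv_div p q hq, ratDeriv_div r s hs]
  simp only [derivative_mul, map_add, map_mul]
  field_simp
  ring

noncomputable instance : Differential (RatFunc C) :=
  differentialOfLeibniz ratDeriv ratDeriv_add ratDeriv_mul

theorem deriv_eq_ratDeriv (f : RatFunc C) : f′ = ratDeriv f := rfl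

theorem deriv_algebraMap_poly (p : C[X]) :
    (algebraMap C[X] (RatFunc C) p)′ = algebraMap C[X] (RatFunc C) (derivative p) := by
  have h := ratDeriv_div p 1 one_ne_zero
  rw [deriv_eq_ratDeriv]
  simpa using h

theorem deriv_algebraMap_const (c : C) : (algebraMap C (RatFunc C) c)′ = 0 := by
  rw [IsScalarTower.algebraMap_apply C C[X] (RatFunc C), deriv_algebraMap_poly]
  simp

end RatFuncDeriv

/-! ### Expansions at the points of `C ∪ {∞}` -/

section Expansions

open scoped OnePoint

/-- Formal series `∑ c_α t ^ α` with well-ordered support in `ℚ`, in the local parameter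
`t = x - ξ` for `ξ ∈ C`, and `t = 1 / x` for `ξ = ∞`.  This is the ambient field for the
Puiseux series at `ξ`, which are singled out by `IsPuiseux`. -/
def GenSeries (C : Type u) [Field C] (_ξ : OnePoint C) : Type u := HahnSeries ℚ C

variable {C : Type u} [Field C]

noncomputable instance (ξ : OnePoint C) : Field (GenSeries C ξ) :=
  inferInstanceAs (Field (HahnSeries ℚ C))

noncomputable instance (ξ : OnePoint C) : Algebra C (GenSeries C ξ) :=
  (HahnSeries.instAlgebra : Algebra C (HahnSeries ℚ C))

variable {ξ : OnePoint C}

namespace GenSeries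

/-- The coefficient of `t ^ α`. -/
def coeff (f : GenSeries C ξ) (α : ℚ) : C := HahnSeries.coeff f α

theorem ext {f g : GenSeries C ξ} (h : ∀ α, f.coeff α = g.coeff α) : f = g :=
  HahnSeries.ext (funext h)

theorem coeff_add (f g : GenSeries C ξ) (α : ℚ) :
    (f + g).coeff α = f.coeff α + g.coeff α := rfl

theorem coeff_zero (α : ℚ) : (0 : GenSeries C ξ).coeff α = 0 := rfl

theorem coeff_smul (c : C) (f : GenSeries C ξ) (α : ℚ) : (c • f).coeff α = c * f.coeff α := rfl

/-- The monomial `c t ^ α`. -/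
noncomputable def monomial (ξ : OnePoint C) (α : ℚ) (c : C) : GenSeries C ξ :=
  (HahnSeries.single α c : HahnSeries ℚ C)

theorem monomial_mul (ξ : OnePoint C) (α β : ℚ) (c d : C) :
    monomial ξ α c * monomial ξ β d = monomial ξ (α + β) (c * d) :=
  HahnSeries.single_mul_single

theorem monomial_zero_one (ξ : OnePoint C) : monomial ξ 0 1 = 1 := rfl

theorem algebraMap_eq (ξ : OnePoint C) (c : C) :
    algebraMap C (GenSeries C ξ) c = monomial ξ 0 c := rfl

/-- `f` is a Puiseux series: its exponents have a common denominator. -/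
def IsPuiseux (f : GenSeries C ξ) : Prop :=
  ∃ q : ℕ, 0 < q ∧ ∀ α : ℚ, f.coeff α ≠ 0 → ∃ n : ℤ, α = n / q

/-- `f` is integral: no negative exponent occurs in it. -/
def IsIntegral (f : GenSeries C ξ) : Prop :=
  ∀ α : ℚ, α < 0 → f.coeff α = 0

/-- The `C`-vector space of Puiseux series at `ξ`. -/
def puiseux (C : Type u) [Field C] (ξ : OnePoint C) : Submodule C (GenSeries C ξ) where
  carrier := {f | f.IsPuiseux}
  zero_mem' := ⟨1, one_pos, fun α h => absurd (coeff_zero α) h⟩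
  add_mem' := by
    rintro f g ⟨q, hq, hf⟩ ⟨r, hr, hg⟩
    refine ⟨q * r, Nat.mul_pos hq hr, fun α h => ?_⟩
    have hq' : (q : ℚ) ≠ 0 := by exact_mod_cast hq.ne'
    have hr' : (r : ℚ) ≠ 0 := by exact_mod_cast hr.ne'
    by_cases h1 : f.coeff α = 0
    · have h2 : g.coeff α ≠ 0 := fun h2 => h (by rw [coeff_add, h1, h2, add_zero])
      obtain ⟨n, hn⟩ := hg α h2
      refine ⟨n * q, ?_⟩
      rw [hn]
      push_cast
      field_simp
    · obtain ⟨n, hn⟩ := hf α h1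
      refine ⟨n * r, ?_⟩
      rw [hn]
      push_cast
      field_simp
  smul_mem' := by
    rintro c f ⟨q, hq, hf⟩
    exact ⟨q, hq, fun α h => hf α fun h0 => h (by rw [coeff_smul, h0, mul_zero])⟩

/-- The expansion of `x` at `ξ`: `x = ξ + t` for `ξ ∈ C` and `x = t ^ (-1)` for `ξ = ∞`. -/
noncomputable def expandX : (ξ : OnePoint C) → GenSeries C ξ
  | ∞ => monomial ∞ (-1) 1
  | (c : C) => algebraMap C (GenSeries C c) c + monomial c 1 1

/-- `dt / dx`, expanded at `ξ`: it is `1` for `ξ ∈ C` and `-t ^ 2` for `ξ = ∞`. -/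
noncomputable def paramDeriv : (ξ : OnePoint C) → GenSeries C ξ
  | ∞ => monomial ∞ 2 (-1)
  | (_ : C) => 1

/-- The Euler derivation `t d/dt`: `∑ c_α t ^ α ↦ ∑ α c_α t ^ α`. -/
def eulerHahn (f : HahnSeries ℚ C) : HahnSeries ℚ C where
  coeff := fun α => (α : C) * f.coeff α
  isPWO_support' := f.isPWO_support.mono fun α h => by
    rw [Function.mem_support] at h
    exact right_ne_zero_of_mul h

theorem coeff_eulerHahn (f : HahnSeries ℚ C) (α : ℚ) :
    (eulerHahn f).coeff α = (α : C) * f.coeff α := rfl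

theorem eulerHahn_mul [CharZero C] (f g : HahnSeries ℚ C) :
    eulerHahn (f * g) = f * eulerHahn g + g * eulerHahn f := by
  ext α
  have hs : ∀ h : HahnSeries ℚ C, (eulerHahn h).support ⊆ h.support :=
    fun h α hα => right_ne_zero_of_mul hα
  rw [HahnSeries.coeff_add, coeff_eulerHahn, mul_comm g,
    HahnSeries.coeff_mul_right' g.isPWO_support (hs g),
    HahnSeries.coeff_mul_left' f.isPWO_support (hs f), HahnSeries.coeff_mul,
    ← Finset.sum_add_distrib, Finset.mul_sum]
  refine Finset.sum_congr rfl fun ij hij => ?_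
  rw [Finset.mem_antidiagonal] at hij
  rw [coeff_eulerHahn, coeff_eulerHahn, ← hij.2.2, Rat.cast_add]
  ring

/-- The Euler derivation `t d/dt` on `GenSeries C ξ`. -/
def eulerDeriv (f : GenSeries C ξ) : GenSeries C ξ := eulerHahn f

theorem eulerDeriv_add (f g : GenSeries C ξ) :
    eulerDeriv (f + g) = eulerDeriv f + eulerDeriv g :=
  ext fun α => mul_add (α : C) (f.coeff α) (g.coeff α)

theorem eulerDeriv_monomial (ξ : OnePoint C) (α : ℚ) (c : C) :
    eulerDeriv (monomial ξ α c) = monomial ξ α (α * c) := by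
  refine ext fun β => ?_
  change (β : C) * (HahnSeries.single α c : HahnSeries ℚ C).coeff β
    = (HahnSeries.single α (α * c) : HahnSeries ℚ C).coeff β
  by_cases h : β = α
  · subst h; simp
  · simp [HahnSeries.coeff_single_of_ne h]

theorem aeval_monomial_injective (ξ : OnePoint C) (α : ℚ) (hα : α ≠ 0) :
    Function.Injective (aeval (R := C) (monomial ξ α 1)) := by
  rw [injective_iff_map_eq_zero]
  intro p hp
  ext n
  have hpow : ∀ k : ℕ, monomial ξ α (1 : C) ^ k = monomial ξ (k * α) 1 := by
    intro k
    induction k with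
    | zero => simp [monomial_zero_one]
    | succ k ih =>
      rw [pow_succ, ih, monomial_mul]
      push_cast
      congr 1 <;> ring
  have hterm : ∀ (k : ℕ) (c : C), c • monomial ξ α (1 : C) ^ k = monomial ξ (k * α) c := by
    intro k c
    rw [hpow, Algebra.smul_def, algebraMap_eq, monomial_mul, zero_add, mul_one]
  rw [aeval_eq_sum_range] at hp
  simp only [hterm] at hp
  by_cases hn : n ∈ Finset.range (p.natDegree + 1)
  · have h2 : (∑ k ∈ Finset.range (p.natDegree + 1),
        (HahnSeries.single ((k : ℚ) * α) (p.coeff k) : HahnSeries ℚ C)).coeff (n * α) = 0 :=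
      congrArg (fun f : GenSeries C ξ => f.coeff (n * α)) hp
    rw [HahnSeries.coeff_sum, Finset.sum_eq_single n] at h2
    · simpa using h2
    · intro k _ hk
      apply HahnSeries.coeff_single_of_ne
      intro h
      apply hk
      exact_mod_cast (mul_right_cancel₀ hα h).symm
    · exact fun h => absurd hn h
  · rw [Finset.mem_range, not_lt] at hn
    rw [Polynomial.coeff_zero]
    exact coeff_eq_zero_of_natDegree_lt (by omega)

theorem aeval_expandX_injective (ξ : OnePoint C) :
    Function.Injective (aeval (R := C) (expandX ξ)) := by
  cases ξ with
  | infty => exact aeval_monomial_injective ∞ (-1) (by norm_num)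
  | coe c =>
    intro p q h
    apply taylor_injective c
    apply aeval_monomial_injective (c : OnePoint C) 1 one_ne_zero
    have hx : ∀ p : C[X], aeval (monomial (c : OnePoint C) 1 1) (taylor c p)
        = aeval (expandX (c : OnePoint C)) p := by
      intro p
      rw [taylor_apply, aeval_comp]
      congr 2
      simp [expandX, add_comm]
    rw [hx, hx, h]

/-- The expansion of rational functions at `ξ`. -/
noncomputable def ratExpand (ξ : OnePoint C) : RatFunc C →ₐ[C] GenSeries C ξ :=
  RatFunc.liftAlgHom (aeval (expandX ξ))
    (nonZeroDivisors_le_comap_nonZeroDivisors_of_injective _ (aeval_expandX_injective ξ))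

noncomputable instance : Algebra (RatFunc C) (GenSeries C ξ) :=
  (ratExpand ξ).toRingHom.toAlgebra

theorem algebraMap_ratFunc (f : RatFunc C) :
    algebraMap (RatFunc C) (GenSeries C ξ) f = ratExpand ξ f := rfl

instance : IsScalarTower C (RatFunc C) (GenSeries C ξ) :=
  IsScalarTower.of_algebraMap_eq fun c => ((ratExpand ξ).commutes c).symm

theorem ratExpand_poly (p : C[X]) :
    ratExpand ξ (algebraMap C[X] (RatFunc C) p) = aeval (expandX ξ) p := by
  have := RatFunc.liftAlgHom_apply_div (aeval (expandX ξ))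
    (nonZeroDivisors_le_comap_nonZeroDivisors_of_injective _ (aeval_expandX_injective ξ)) p 1
  simpa [ratExpand] using this

variable [CharZero C]

theorem eulerDeriv_mul (f g : GenSeries C ξ) :
    eulerDeriv (f * g) = f * eulerDeriv g + g * eulerDeriv f := eulerHahn_mul f g

/-- The derivation `d/dx = (dt/dx) t ^ (-1) (t d/dt)`: on `∑ c_α t ^ α` it gives
`∑ α c_α t ^ (α - 1)` at `ξ ∈ C`, and `-∑ α c_α t ^ (α + 1)` at `ξ = ∞`. -/
noncomputable instance : Differential (GenSeries C ξ) :=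
  differentialOfLeibniz (fun f => paramDeriv ξ * monomial ξ (-1) 1 * eulerDeriv f)
    (fun f g => by rw [eulerDeriv_add, mul_add])
    (fun f g => by rw [eulerDeriv_mul]; ring)

theorem deriv_def (f : GenSeries C ξ) :
    f′ = paramDeriv ξ * monomial ξ (-1) 1 * eulerDeriv f := rfl

theorem deriv_const (ξ : OnePoint C) (c : C) : (algebraMap C (GenSeries C ξ) c)′ = 0 := by
  rw [deriv_def, algebraMap_eq, eulerDeriv_monomial, Rat.cast_zero, zero_mul]
  have : monomial ξ 0 (0 : C) = 0 := HahnSeries.single_eq_zero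
  rw [this, mul_zero]

theorem deriv_expandX (ξ : OnePoint C) : (expandX ξ)′ = 1 := by
  cases ξ with
  | infty =>
    change (monomial ∞ (-1) (1 : C))′ = 1
    rw [deriv_def, eulerDeriv_monomial]
    change monomial ∞ 2 (-1) * _ * _ = _
    rw [monomial_mul, monomial_mul, ← monomial_zero_one]
    norm_num
  | coe c =>
    change (algebraMap C (GenSeries C c) c + monomial c 1 1)′ = 1
    rw [map_add, deriv_const, deriv_def, eulerDeriv_monomial]
    change _ + 1 * _ * _ = _
    rw [one_mul, monomial_mul, ← monomial_zero_one]
    norm_num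

theorem deriv_aeval_expandX (p : C[X]) :
    (aeval (expandX ξ) p)′ = aeval (expandX ξ) (derivative p) := by
  induction p using Polynomial.induction_on' with
  | add p q hp hq => simp only [map_add, hp, hq]
  | monomial n a =>
    rw [aeval_monomial, Derivation.leibniz, deriv_const, Derivation.leibniz_pow,
      deriv_expandX, derivative_monomial, aeval_monomial]
    simp only [smul_eq_mul, mul_one, mul_zero, add_zero, nsmul_eq_mul, map_mul, map_natCast]
    ring

instance : DifferentialAlgebra (RatFunc C) (GenSeries C ξ) where
  deriv_algebraMap f := by
    simp only [algebraMap_ratFunc]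
    induction f using RatFunc.induction_on with | f p q hq
    have hq' : aeval (expandX ξ) q ≠ 0 := fun h =>
      hq (aeval_expandX_injective ξ (by rw [h, map_zero]))
    rw [deriv_eq_ratDeriv, ratDeriv_div p q hq]
    simp only [map_div₀, map_sub, map_mul, map_pow, ratExpand_poly, ← deriv_aeval_expandX]
    have h := Derivation.leibniz (Differential.deriv : Derivation ℤ (GenSeries C ξ) (GenSeries C ξ))
      (aeval (expandX ξ) p / aeval (expandX ξ) q) (aeval (expandX ξ) q)
    rw [div_mul_cancel₀ _ hq'] at h
    simp only [smul_eq_mul] at h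
    rw [h, eq_div_iff (pow_ne_zero 2 hq')]
    field_simp
    ring

end GenSeries

end Expansions

/-! ### Solution spaces -/

section Solutions

variable {C : Type u} [Field C]

/-- The `C`-vector space `V(L)` of the solutions of `L` in a differential extension of `C(x)`. -/
noncomputable def solutions (L : DiffOp (RatFunc C)) (F : Type*) [CommRing F] [Algebra C F]
    [Algebra (RatFunc C) F] [IsScalarTower C (RatFunc C) F] [Differential F]
    [DifferentialAlgebra (RatFunc C) F] : Submodule C F where
  carrier := {f | L • f = 0}
  zero_mem' := smul_zero L
  add_mem' := by
    intro f g hf hg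
    change L • (f + g) = 0
    rw [smul_add, show L • f = 0 from hf, show L • g = 0 from hg, add_zero]
  smul_mem' := by
    intro c f hf
    have h1 : c • f = DiffOp.const (algebraMap C (RatFunc C) c) • f := by
      rw [DiffOp.const_smul, algebraMap_smul]
    have h2 : L * DiffOp.const (algebraMap C (RatFunc C) c)
        = DiffOp.const (algebraMap C (RatFunc C) c) * L :=
      DiffOp.mul_const_of_deriv_eq_zero L _ (deriv_algebraMap_const c)
    change L • (c • f) = 0
    rw [h1, ← mul_smul, h2, mul_smul, show L • f = 0 from hf, smul_zero]

/-- `L` has only algebraic solutions: in some differential field `E` that is a finite extension of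
`C(x)`, the solution space of `L` has dimension `ord L` (it has a basis of that length). -/
def HasOnlyAlgebraicSolutions (L : DiffOp (RatFunc C)) : Prop :=
  ∃ (E : Type u) (_ : Field E) (_ : Algebra C E) (_ : Algebra (RatFunc C) E)
    (_ : IsScalarTower C (RatFunc C) E) (_ : FiniteDimensional (RatFunc C) E)
    (_ : Differential E) (_ : DifferentialAlgebra (RatFunc C) E),
    Nonempty (Module.Basis (Fin L.ord) C (solutions L E))

/-- The Puiseux series solutions of `L` at `ξ`. -/
noncomputable def puiseuxSolutions [CharZero C] (L : DiffOp (RatFunc C)) (ξ : OnePoint C) :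
    Submodule C (GenSeries C ξ) :=
  solutions L (GenSeries C ξ) ⊓ GenSeries.puiseux C ξ

/-- At every `ξ ∈ C ∪ {∞}` the operator `L` has a basis of `ord L` Puiseux series solutions. -/
def HasPuiseuxBases [CharZero C] (L : DiffOp (RatFunc C)) : Prop :=
  ∀ ξ : OnePoint C, Nonempty (Module.Basis (Fin L.ord) C (puiseuxSolutions L ξ))

end Solutions

/-! ### Integral elements and pseudoconstants -/

section Pseudoconstants

/-- The left module `K[D]/⟨L⟩`, where `⟨L⟩ = {P * L | P ∈ K[D]}`. -/
abbrev DiffOp.Quo {K : Type*} [Field K] [Differential K] (L : DiffOp K) : Type _ :=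
  DiffOp K ⧸ Submodule.span (DiffOp K) {L}

/-- For a solution `f` of `L`, the map `[P] ↦ P • f` on `K[D]/⟨L⟩`. -/
noncomputable def DiffOp.evalAt {K : Type*} [Field K] [Differential K] {L : DiffOp K}
    {F : Type*} [CommRing F] [Algebra K F] [Differential F] [DifferentialAlgebra K F]
    (f : F) (hf : L • f = 0) : L.Quo →ₗ[DiffOp K] F :=
  Submodule.liftQ _ (LinearMap.toSpanSingleton (DiffOp K) F f) <| by
    rw [Submodule.span_singleton_le_iff_mem, LinearMap.mem_ker]
    exact hf

theorem DiffOp.evalAt_mk {K : Type*} [Field K] [Differential K] {L : DiffOp K}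
    {F : Type*} [CommRing F] [Algebra K F] [Differential F] [DifferentialAlgebra K F]
    (f : F) (hf : L • f = 0) (P : DiffOp K) :
    DiffOp.evalAt f hf (Submodule.Quotient.mk P) = P • f := rfl

variable {C : Type u} [Field C] [CharZero C] {L : DiffOp (RatFunc C)}

/-- `[P]` is integral at `ξ`: the series `P • f` is integral for every Puiseux series solution
`f` of `L` at `ξ`. -/
def IsIntegralAt (p : L.Quo) (ξ : OnePoint C) : Prop :=
  ∀ (f : GenSeries C ξ) (hf : L • f = 0), f.IsPuiseux → (DiffOp.evalAt f hf p).IsIntegral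

/-- `[P]` is completely integral: it is integral at every `ξ ∈ C ∪ {∞}`. -/
def IsCompletelyIntegral (p : L.Quo) : Prop :=
  ∀ ξ : OnePoint C, IsIntegralAt p ξ

/-- `[P]` is a pseudoconstant: it is completely integral, but not a constant, that is,
`D • [P] ≠ 0`. -/
def IsPseudoconstant (p : L.Quo) : Prop :=
  IsCompletelyIntegral p ∧ (DiffOp.D : DiffOp (RatFunc C)) • p ≠ 0

/-- `L` has a pseudoconstant. -/
def HasPseudoconstant (L : DiffOp (RatFunc C)) : Prop :=
  ∃ p : L.Quo, IsPseudoconstant p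

end Pseudoconstants

/-! ### Symmetric products and symmetric powers -/

namespace DiffOp

section SymProd

variable {K : Type u} [Field K] [Differential K]

/-- `N` annihilates `f * g` whenever `f` is a solution of `L` and `g` is a solution of `M`, in any
differential field that extends `K`. -/
def AnnihilatesProducts (L M N : DiffOp K) : Prop :=
  ∀ (F : Type u) [Field F] [Algebra K F] [Differential F] [DifferentialAlgebra K F] (f g : F),
    L • f = 0 → M • g = 0 → N • (f * g) = 0

/-- `N` is a symmetric product of `L` and `M`: a monic operator of lowest order among those which
annihilate all products of a solution of `L` and a solution of `M`. -/
def IsSymProd (L M N : DiffOp K) : Prop :=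
  N.Monic ∧ AnnihilatesProducts L M N ∧
    ∀ N' : DiffOp K, N'.Monic → AnnihilatesProducts L M N' → N.ord ≤ N'.ord

theorem exists_monic_smul (N : DiffOp K) (hN : N ≠ 0) : ∃ a : K,
    (const a * N).Monic ∧ (const a * N).ord = N.ord := by
  have h0 : N.toPoly ≠ 0 := fun h => hN (DiffOp.ext h)
  refine ⟨N.toPoly.leadingCoeff⁻¹, ?_, ?_⟩
  · rw [Monic, toPoly_const_mul, smul_eq_C_mul, mul_comm]
    exact monic_mul_leadingCoeff_inv h0
  · rw [ord, toPoly_const_mul]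
    exact natDegree_smul _ (inv_ne_zero (leadingCoeff_ne_zero.mpr h0))

theorem AnnihilatesProducts.const_mul {L M N : DiffOp K} (h : AnnihilatesProducts L M N) (a : K) :
    AnnihilatesProducts L M (const a * N) := by
  intro F _ _ _ _ f g hf hg
  rw [mul_smul, h F f g hf hg, smul_zero]

theorem IsSymProd.unique {L M N N' : DiffOp K} (h : IsSymProd L M N) (h' : IsSymProd L M N') :
    N = N' := by
  by_contra hne
  have hord : N.ord = N'.ord := le_antisymm (h.2.2 N' h'.1 h'.2.1) (h'.2.2 N h.1 h.2.1)
  have hs : N - N' ≠ 0 := sub_ne_zero.mpr hne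
  obtain ⟨a, ha, ha'⟩ := exists_monic_smul (N - N') hs
  have hann : AnnihilatesProducts L M (N - N') := by
    intro F _ _ _ _ f g hf hg
    rw [sub_smul, h.2.1 F f g hf hg, h'.2.1 F f g hf hg, sub_zero]
  have hle := h.2.2 _ ha (hann.const_mul a)
  rw [ha'] at hle
  have hp : N.toPoly - N'.toPoly ≠ 0 := fun h0 => hs (DiffOp.ext h0)
  have hdeg : (N.toPoly - N'.toPoly).degree < N.toPoly.degree := by
    apply degree_sub_lt_left
    · rw [degree_eq_natDegree h.1.ne_zero, degree_eq_natDegree h'.1.ne_zero]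
      exact congrArg _ hord
    · exact h.1.ne_zero
    · rw [h.1.leadingCoeff, h'.1.leadingCoeff]
  have hlt : (N - N').ord < N.ord := natDegree_lt_natDegree hp hdeg
  omega

section Existence

variable {R : Type*} [CommRing R] [Algebra K R] [Differential R] [DifferentialAlgebra K R]

theorem exists_stable_submodule (L : DiffOp K) (hL : L ≠ 0) (f : R)
    (hf : act (derivHom R) L.toPoly f = 0) :
    ∃ U : Submodule K R, U.FG ∧ f ∈ U ∧ ∀ u ∈ U, u′ ∈ U := by
  classical
  have h0 : L.toPoly ≠ 0 := fun h => hL (DiffOp.ext h)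
  set d : ℕ → R := fun i => (derivHom R)^[i] f with hd
  set s : Finset R := (Finset.range L.ord).image d with hs
  have hmem : ∀ i < L.ord, d i ∈ Submodule.span K (s : Set R) := fun i hi =>
    Submodule.subset_span (Finset.mem_coe.mpr
      (Finset.mem_image_of_mem d (Finset.mem_range.mpr hi)))
  have htop : d L.ord ∈ Submodule.span K (s : Set R) := by
    have h1 : L.toPoly.sum (fun i a => a • d i) = 0 := hf
    rw [Polynomial.sum_over_range _ (by simp), Finset.sum_range_succ] at h1
    have h2 : L.toPoly.leadingCoeff • d L.ord ∈ Submodule.span K (s : Set R) := by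
      have h3 : L.toPoly.leadingCoeff • d L.ord
          = -∑ i ∈ Finset.range L.ord, L.toPoly.coeff i • d i := by
        rw [eq_neg_iff_add_eq_zero, add_comm]
        exact h1
      rw [h3]
      exact neg_mem (sum_mem fun i hi => Submodule.smul_mem _ _ (hmem i (Finset.mem_range.mp hi)))
    exact (Submodule.smul_mem_iff _ (leadingCoeff_ne_zero.mpr h0)).mp h2
  have hle : ∀ i ≤ L.ord, d i ∈ Submodule.span K (s : Set R) := fun i hi =>
    hi.lt_or_eq.elim (hmem i) fun h => h ▸ htop
  refine ⟨Submodule.span K (s : Set R), ⟨s, rfl⟩, hle 0 (Nat.zero_le _), fun u hu => ?_⟩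
  induction hu using Submodule.span_induction with
  | mem x hx =>
    obtain ⟨i, hi, rfl⟩ := Finset.mem_image.mp (Finset.mem_coe.mp hx)
    have h4 : (d i)′ = d (i + 1) := (Function.iterate_succ_apply' (derivHom R) i f).symm
    rw [h4]
    exact hle _ (Finset.mem_range.mp hi)
  | zero => rw [map_zero]; exact zero_mem _
  | add x y _ _ hx hy => rw [map_add]; exact add_mem hx hy
  | smul a x hx' hx =>
    rw [deriv_smul]
    exact add_mem (Submodule.smul_mem _ _ hx') (Submodule.smul_mem _ _ hx)

theorem exists_annihilator_mul (L M : DiffOp K) (hL : L ≠ 0) (hM : M ≠ 0) (f g : R)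
    (hf : act (derivHom R) L.toPoly f = 0) (hg : act (derivHom R) M.toPoly g = 0) :
    ∃ N : DiffOp K, N ≠ 0 ∧ act (derivHom R) N.toPoly (f * g) = 0 := by
  obtain ⟨U, hU, hfU, hU'⟩ := exists_stable_submodule L hL f hf
  obtain ⟨V, hV, hgV, hV'⟩ := exists_stable_submodule M hM g hg
  have hst : ∀ w ∈ U * V, w′ ∈ U * V := by
    intro w hw
    induction hw using Submodule.mul_induction_on' with
    | mem_mul_mem m hm n hn =>
      rw [Derivation.leibniz, smul_eq_mul, smul_eq_mul, mul_comm n]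
      exact add_mem (Submodule.mul_mem_mul hm (hV' n hn)) (Submodule.mul_mem_mul (hU' m hm) hn)
    | add x _ y _ hx hy => rw [map_add]; exact add_mem hx hy
  have hit : ∀ i : ℕ, (derivHom R)^[i] (f * g) ∈ U * V := by
    intro i
    induction i with
    | zero => exact Submodule.mul_mem_mul hfU hgV
    | succ i ih => rw [Function.iterate_succ_apply']; exact hst _ ih
  have hact : ∀ P : K[X], act (derivHom R) P (f * g) ∈ U * V := fun P =>
    sum_mem fun i _ => Submodule.smul_mem _ _ (hit i)
  let φ : K[X] →ₗ[K] (U * V : Submodule K R) :=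
    { toFun := fun P => ⟨act (derivHom R) P (f * g), hact P⟩
      map_add' := fun P Q => Subtype.ext (act_add _ P Q _)
      map_smul' := fun a P => Subtype.ext (act_smul _ a P _) }
  have : Module.Finite K (U * V : Submodule K R) := Module.Finite.iff_fg.mpr (hU.mul hV)
  have hni : ¬ Function.Injective φ := fun h =>
    Polynomial.not_finite (Module.Finite.of_injective φ h)
  rw [injective_iff_map_eq_zero] at hni
  push Not at hni
  obtain ⟨P, hP, hP0⟩ := hni
  exact ⟨⟨P⟩, fun h => hP0 (congrArg toPoly h), congrArg Subtype.val hP⟩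

end Existence

/-- A pair of solutions of `L` and `M` in some differential field that extends `K`. -/
structure SolPair (L M : DiffOp K) where
  /-- the differential field -/
  F : Type u
  [field : Field F]
  [alg : Algebra K F]
  [diff : Differential F]
  [dalg : DifferentialAlgebra K F]
  /-- a solution of `L` -/
  f : F
  /-- a solution of `M` -/
  g : F
  hf : L • f = 0
  hg : M • g = 0

attribute [instance] SolPair.field SolPair.alg SolPair.diff SolPair.dalg

@[reducible]
noncomputable def piDifferential {ι : Type*} (F : ι → Type*) [∀ i, CommRing (F i)]
    [∀ i, Differential (F i)] : Differential (∀ i, F i) :=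
  differentialOfLeibniz (fun f i => (f i)′) (fun f g => funext fun i => map_add _ (f i) (g i))
    (fun f g => funext fun i => Derivation.leibniz _ (f i) (g i))

theorem exists_annihilatesProducts (L M : DiffOp K) (hL : L ≠ 0) (hM : M ≠ 0) :
    ∃ N : DiffOp K, N ≠ 0 ∧ AnnihilatesProducts L M N := by
  let _ : Differential (∀ x : SolPair L M, x.F) := piDifferential _
  have : DifferentialAlgebra K (∀ x : SolPair L M, x.F) :=
    ⟨fun a => funext fun x => deriv_algebraMap (B := x.F) a⟩
  have hpi : ∀ (P : DiffOp K) (h : ∀ x : SolPair L M, x.F) (x : SolPair L M),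
      act (derivHom (∀ x : SolPair L M, x.F)) P.toPoly h x = P • h x := by
    intro P h x
    have hi : ∀ i : ℕ, ((derivHom (∀ x : SolPair L M, x.F))^[i] h) x
        = (derivHom x.F)^[i] (h x) := by
      intro i
      induction i with
      | zero => rfl
      | succ i ih =>
        rw [Function.iterate_succ_apply', Function.iterate_succ_apply', ← ih]
        rfl
    change (P.toPoly.sum fun i a => a • ((derivHom (∀ x : SolPair L M, x.F))^[i] h)) x
      = P.toPoly.sum fun i a => a • ((derivHom x.F)^[i] (h x))
    simp only [Polynomial.sum, Finset.sum_apply, Pi.smul_apply, hi]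
  obtain ⟨N, hN, hN'⟩ := exists_annihilator_mul L M hL hM
    (fun x : SolPair L M => x.f) (fun x : SolPair L M => x.g)
    (funext fun x => (hpi L _ x).trans x.hf) (funext fun x => (hpi M _ x).trans x.hg)
  refine ⟨N, hN, ?_⟩
  intro F _ _ _ _ f g hf hg
  have h := congrFun hN' ⟨F, f, g, hf, hg⟩
  rw [hpi] at h
  exact h

/-- Nonzero operators have a symmetric product. -/
theorem exists_isSymProd (L M : DiffOp K) (hL : L ≠ 0) (hM : M ≠ 0) :
    ∃ N : DiffOp K, IsSymProd L M N := by
  classical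
  have hex : ∃ n : ℕ, ∃ N : DiffOp K, N.Monic ∧ AnnihilatesProducts L M N ∧ N.ord = n := by
    obtain ⟨N, hN, hann⟩ := exists_annihilatesProducts L M hL hM
    obtain ⟨a, ha, _⟩ := exists_monic_smul N hN
    exact ⟨_, _, ha, hann.const_mul a, rfl⟩
  obtain ⟨N, h1, h2, h3⟩ := Nat.find_spec hex
  refine ⟨N, h1, h2, fun N' h1' h2' => ?_⟩
  rw [h3]
  exact Nat.find_min' hex ⟨N', h1', h2', rfl⟩

open Classical in
/-- The symmetric product `L ⊗ M` of two nonzero operators (and `0` if one of them is `0`). -/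
noncomputable def symProd (L M : DiffOp K) : DiffOp K :=
  if h : L ≠ 0 ∧ M ≠ 0 then (exists_isSymProd L M h.1 h.2).choose else 0

theorem symProd_spec (L M : DiffOp K) (hL : L ≠ 0) (hM : M ≠ 0) : IsSymProd L M (symProd L M) := by
  rw [symProd, dif_pos ⟨hL, hM⟩]
  exact (exists_isSymProd L M hL hM).choose_spec

/-- The symmetric power `L ⊗ ⋯ ⊗ L` with `s ≥ 1` factors (and `D`, which is neutral for `⊗`,
for `s = 0`). -/
noncomputable def symPow (L : DiffOp K) : ℕ → DiffOp K
  | 0 => D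
  | 1 => L
  | s + 2 => symProd (symPow L (s + 1)) L

end SymProd

end DiffOp

/-! Suppose that some differential field A, algebraic over C(x), contains ord L independent
solutions of L, and let [P] be completely integral for the symmetric power M of L. For a product h
of solutions of L in A, the value P • h is an algebraic function. Its conjugates over the series at
ξ are P • σ(h), and σ(h) is again a product of solutions of L, each of which is a Puiseux series
because the Puiseux solutions already exhaust the solution space. So every conjugate is integral at
every ξ, and hence so are the coefficients of the minimal polynomial of P • h. These are rational
functions without poles, so they lie in C, and so does P • h. Thus D P annihilates all products of
solutions (`deriv_smul_eq_zero_of_isCompletelyIntegral`).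

It remains to conclude that D P is a left multiple of M. This needs enough products: no nonzero
operator of order below ord M may kill all of them. For L this is the nonvanishing of the Wronskian
(`nondegenerate_of_linearIndependent`), and it passes to symmetric products because M has minimal
order (`Nondegenerate.mul_symProd`). Right division by M then gives D • [P] = 0, so [P] is not a
pseudoconstant. Both conclusions of the theorem are instances, with A the given finite extension or
the algebraic closure of C(x) in the series field at ξ. -/

/-! ### Derivations on algebraic extensions -/

section AlgebraicExtension

open TensorProduct in
/-- The extension of the derivation of a field to a separable algebraic extension. -/
@[reducible]
noncomputable def differentialOfSeparable (F E : Type*) [Field F] [Field E] [Differential F]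
    [Algebra F E] [Algebra.IsSeparable F E] : Differential E :=
  -- For an étale extension the differentials of E are E ⊗ Ω_F, so the linear form on Ω_F that
  -- defines the derivation of F extends by base change.
  have : Algebra.FormallyEtale F E := Algebra.FormallyEtale.of_isSeparable F E
  ⟨((LinearMap.liftBaseChange E ((Algebra.linearMap F E).comp
      (Differential.deriv : Derivation ℤ F F).liftKaehlerDifferential)).comp
    (KaehlerDifferential.tensorKaehlerEquivOfFormallyEtale ℤ F E).symm.toLinearMap).compDer
      (KaehlerDifferential.D ℤ E)⟩

theorem differentialAlgebra_of_separable (F E : Type*) [Field F] [Field E] [Differential F]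
    [Algebra F E] [Algebra.IsSeparable F E] :
    let _ := differentialOfSeparable F E
    DifferentialAlgebra F E := by
  have : Algebra.FormallyEtale F E := Algebra.FormallyEtale.of_isSeparable F E
  let _ := differentialOfSeparable F E
  refine ⟨fun a => ?_⟩
  change (LinearMap.liftBaseChange E _)
    ((KaehlerDifferential.tensorKaehlerEquivOfFormallyEtale ℤ F E).symm
      (KaehlerDifferential.D ℤ E (algebraMap F E a))) = _
  rw [KaehlerDifferential.tensorKaehlerEquivOfFormallyEtale_symm_D_algebraMap]
  simp

noncomputable instance (F : Type*) [Field F] [CharZero F] [Differential F] :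
    Differential (AlgebraicClosure F) := differentialOfSeparable F _

instance (F : Type*) [Field F] [CharZero F] [Differential F] :
    DifferentialAlgebra F (AlgebraicClosure F) := differentialAlgebra_of_separable F _

theorem DifferentialAlgebra.trans (A B E : Type*) [CommRing A] [CommRing B] [CommRing E]
    [Algebra A B] [Algebra B E] [Algebra A E] [IsScalarTower A B E] [Differential A]
    [Differential B] [Differential E] [DifferentialAlgebra A B] [DifferentialAlgebra B E] :
    DifferentialAlgebra A E :=
  ⟨fun a => by
    rw [IsScalarTower.algebraMap_apply A B E, deriv_algebraMap, deriv_algebraMap,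
      ← IsScalarTower.algebraMap_apply]⟩

/-- Embeddings of algebraic extensions of a differential field commute with the derivation. -/
theorem AlgHom.map_deriv_of_isAlgebraic {K A F : Type*} [Field K] [CharZero K] [Field A] [Field F]
    [Differential K] [Differential A] [Differential F] [Algebra K A] [Algebra K F]
    [DifferentialAlgebra K A] [DifferentialAlgebra K F] [Algebra.IsAlgebraic K A]
    (φ : A →ₐ[K] F) (x : A) : φ x′ = (φ x)′ := by
  have hint : IsIntegral K x := Algebra.IsIntegral.isIntegral x
  have hsep : aeval (φ x) (derivative (minpoly K x)) ≠ 0 := by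
    rw [aeval_algHom_apply, Ne, map_eq_zero_iff φ φ.injective]
    exact (minpoly.irreducible hint).separable.aeval_derivative_ne_zero (minpoly.aeval K x)
  -- Differentiating m(x) = 0, with m the minimal polynomial, gives a linear equation for x′ with
  -- leading factor m′(x). Both φ(x′) and (φ x)′ solve its image under φ, whose leading factor is
  -- nonzero by separability.
  have h1 := congrArg φ (Differential.deriv_aeval_eq x (minpoly K x))
  have h2 := Differential.deriv_aeval_eq (φ x) (minpoly K x)
  rw [minpoly.aeval, map_zero, map_zero, map_add, map_mul, ← aeval_algHom_apply,
    ← aeval_algHom_apply] at h1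
  rw [aeval_algHom_apply, minpoly.aeval, map_zero, map_zero] at h2
  refine mul_left_cancel₀ hsep ?_
  linear_combination h2 - h1

/-! ### Constants of algebraic extensions. -/

/-- Roots of polynomials with coefficients in an algebraically closed subfield lie in it. -/
theorem mem_range_of_coeff_mem_range (C : Type*) {F E : Type*} [Field C] [IsAlgClosed C] [Field F]
    [Field E] [Algebra C F] [Algebra F E] [Algebra C E] [IsScalarTower C F E] {p : F[X]}
    (hp : p ≠ 0) (hc : ∀ i, p.coeff i ∈ (algebraMap C F).range) {x : E} (hx : aeval x p = 0) :
    x ∈ (algebraMap C E).range := by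
  obtain ⟨q, rfl⟩ := (mem_lifts _).mp ((lifts_iff_coeff_lifts _).mpr hc)
  rw [aeval_map_algebraMap] at hx
  have hq : q ≠ 0 := fun h => hp (by rw [h, Polynomial.map_zero])
  exact minpoly.mem_range_of_degree_eq_one C x (IsAlgClosed.degree_eq_one_of_irreducible C
    (minpoly.irreducible (isAlgebraic_iff_isIntegral.mp ⟨q, hq, hx⟩)))

/-- If `F` has no constants outside of the algebraically closed field `C`, then the same holds for
algebraic extensions of `F`. -/
theorem containConstants_of_isAlgebraic (C F E : Type*) [Field C] [IsAlgClosed C] [Field F]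
    [Field E] [Algebra C F] [Algebra F E] [Algebra C E] [IsScalarTower C F E] [Differential F]
    [Differential E] [DifferentialAlgebra F E] [Algebra.IsAlgebraic F E]
    [Differential.ContainConstants C F] : Differential.ContainConstants C E := by
  refine ⟨fun {x} hx => ?_⟩
  have hint : IsIntegral F x := Algebra.IsIntegral.isIntegral x
  have h0 : aeval x (Differential.mapCoeffs (minpoly F x)) = 0 := by
    have h := Differential.deriv_aeval_eq x (minpoly F x)
    rw [minpoly.aeval, map_zero, hx, mul_zero, add_zero] at h
    exact h.symm
  -- Differentiating the coefficients of a monic polynomial lowers its degree, so by minimality the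
  -- result can vanish at x only if it is zero. Hence the coefficients of the minimal polynomial are
  -- constants.
  have h1 : Differential.mapCoeffs (minpoly F x) = 0 := by
    by_contra hne
    refine (minpoly.degree_le_of_ne_zero F x hne h0).not_gt ?_
    have hm := minpoly.monic hint
    rw [degree_eq_natDegree hm.ne_zero, degree_lt_iff_coeff_zero]
    intro m h
    rw [Differential.coeff_mapCoeffs]
    obtain rfl | h := h.eq_or_lt
    · rw [hm.coeff_natDegree, Derivation.map_one_eq_zero]
    · rw [coeff_eq_zero_of_natDegree_lt h, map_zero]
  refine mem_range_of_coeff_mem_range C (minpoly.ne_zero hint) (fun i => ?_) (minpoly.aeval F x)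
  refine mem_range_of_deriv_eq_zero C ?_
  rw [← Differential.coeff_mapCoeffs, h1, coeff_zero]

end AlgebraicExtension

/-! ### Reduction modulo an operator -/

namespace DiffOp

section Division

variable {K : Type*} [Field K] [Differential K]

theorem degree_leftD_le (P : K[X]) (n : ℕ) (h : P.degree < n) : (leftD P).degree < (n + 1 : ℕ) := by
  rw [degree_lt_iff_coeff_zero] at h ⊢
  intro m hm
  obtain ⟨m, rfl⟩ : ∃ k, m = k + 1 := ⟨m - 1, by omega⟩
  simp only [leftD, AddMonoidHom.add_apply, AddMonoidHom.coe_mulLeft, coeff_add, coeff_X_mul]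
  change P.coeff m + (P.coeff (m + 1))′ = 0
  rw [h m (by omega), h (m + 1) (by omega), map_zero, add_zero]

theorem toPoly_D_mul (P : DiffOp K) : (D * P).toPoly = leftD P.toPoly := by
  rw [toPoly_mul, D, ← monomial_one_one_eq_X, act_monomial, one_smul, Function.iterate_one]

/-- Right division with remainder in `K[D]`. -/
theorem exists_eq_mul_add (L : DiffOp K) (hL : L ≠ 0) (P : DiffOp K) :
    ∃ Q R : DiffOp K, P = Q * L + R ∧ R.toPoly.degree < L.ord := by
  have h0 : L.toPoly ≠ 0 := fun h => hL (DiffOp.ext h)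
  -- If R has order at most ord L, subtracting one left multiple of L by a function removes the term
  -- of order ord L.
  have hred : ∀ R : DiffOp K, R.toPoly.degree < (L.ord + 1 : ℕ) →
      ∃ Q R' : DiffOp K, R = Q * L + R' ∧ R'.toPoly.degree < L.ord := by
    intro R hR
    obtain ⟨a, ha⟩ : ∃ a : K, a = R.toPoly.coeff L.ord / L.toPoly.leadingCoeff := ⟨_, rfl⟩
    have hsub : (R - const a * L).toPoly = R.toPoly - a • L.toPoly := by
      rw [← toPoly_const_mul]
      rfl
    refine ⟨const a, R - const a * L, (add_sub_cancel _ _).symm, ?_⟩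
    rw [hsub, degree_lt_iff_coeff_zero, ha]
    intro m hm
    rw [coeff_sub, coeff_smul, smul_eq_mul]
    obtain rfl | hm := hm.eq_or_lt
    · rw [show L.toPoly.coeff L.ord = L.toPoly.leadingCoeff from rfl,
        div_mul_cancel₀ _ (leadingCoeff_ne_zero.mpr h0), sub_self]
    · rw [degree_lt_iff_coeff_zero] at hR
      rw [hR m hm, coeff_eq_zero_of_natDegree_lt (p := L.toPoly) hm, mul_zero, sub_zero]
  -- Multiplying a remainder by D raises its order by at most one, so a single reduction suffices
  -- again. This carries the induction over the powers of D.
  have hD : ∀ P : DiffOp K, (∃ Q R : DiffOp K, P = Q * L + R ∧ R.toPoly.degree < L.ord) →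
      ∃ Q R : DiffOp K, D * P = Q * L + R ∧ R.toPoly.degree < L.ord := by
    rintro _ ⟨Q, R, rfl, hR⟩
    obtain ⟨Q', R', h, hR'⟩ := hred (D * R) (by
      rw [toPoly_D_mul]; exact degree_leftD_le _ _ hR)
    exact ⟨D * Q + Q', R', by rw [mul_add, h, add_mul, mul_assoc]; abel, hR'⟩
  have hmon : ∀ i : ℕ, ∃ Q R : DiffOp K, (⟨monomial i 1⟩ : DiffOp K) = Q * L + R ∧
      R.toPoly.degree < L.ord := by
    intro i
    induction i with
    | zero =>
      exact hred _ (by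
        refine (degree_monomial_le _ _).trans_lt ?_
        exact_mod_cast L.ord.succ_pos)
    | succ i ih =>
      have h : (⟨monomial (i + 1) 1⟩ : DiffOp K) = D * ⟨monomial i 1⟩ := by
        ext1
        rw [toPoly_D_mul, leftD_monomial]
        simp
      rw [h]
      exact hD _ ih
  obtain ⟨p⟩ := P
  induction p using Polynomial.induction_on' with
  | add p q hp hq =>
    obtain ⟨Q, R, h, hR⟩ := hp
    obtain ⟨Q', R', h', hR'⟩ := hq
    refine ⟨Q + Q', R + R', ?_, ?_⟩
    · change (⟨p⟩ : DiffOp K) + ⟨q⟩ = _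
      rw [h, h', add_mul]
      abel
    · exact (degree_add_le _ _).trans_lt (max_lt hR hR')
  | monomial i a =>
    obtain ⟨Q, R, h, hR⟩ := hmon i
    refine ⟨const a * Q, const a * R, ?_, ?_⟩
    · rw [mul_assoc, ← mul_add, ← h]
      ext1
      rw [toPoly_const_mul, smul_monomial, smul_eq_mul, mul_one]
    · rw [toPoly_const_mul]
      exact (degree_smul_le _ _).trans_lt hR

section Action

variable {F : Type*} [CommRing F] [Algebra K F] [Differential F] [DifferentialAlgebra K F]

theorem smul_eq_sum (P : DiffOp K) {n : ℕ} (hP : P.toPoly.degree < n) (f : F) :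
    P • f = ∑ a : Fin n, P.toPoly.coeff a • (derivHom F)^[a] f := by
  rw [smul_def, act, Polynomial.sum_def, ← Fin.sum_univ_eq_sum_range
    (fun a => P.toPoly.coeff a • (derivHom F)^[a] f) n |>.symm]
  refine Finset.sum_subset (fun a ha => ?_) (fun a _ ha => ?_)
  · rw [Finset.mem_range]
    by_contra h
    exact (mem_support_iff.mp ha) (degree_lt_iff_coeff_zero _ _ |>.mp hP a (not_lt.mp h))
  · rw [notMem_support_iff.mp ha, zero_smul]

theorem monomial_smul (i : ℕ) (a : K) (f : F) :
    (⟨monomial i a⟩ : DiffOp K) • f = a • (derivHom F)^[i] f := by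
  rw [smul_def, act_monomial]

theorem _root_.AlgHom.map_diffOp_smul {A B : Type*} [CommRing A] [CommRing B] [Algebra K A]
    [Algebra K B] [Differential A] [Differential B] [DifferentialAlgebra K A]
    [DifferentialAlgebra K B] (φ : A →ₐ[K] B) (hφ : ∀ x : A, φ x′ = (φ x)′)
    (P : DiffOp K) (f : A) : φ (P • f) = P • φ f := by
  have hit : ∀ i : ℕ, φ ((derivHom A)^[i] f) = (derivHom B)^[i] (φ f) := by
    intro i
    induction i with
    | zero => rfl
    | succ i ih => rw [Function.iterate_succ_apply', Function.iterate_succ_apply', ← ih,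
        derivHom_apply, derivHom_apply, hφ]
  simp only [smul_def, act, Polynomial.sum_def, map_sum, map_smul, hit]

end Action

/-- Higher derivatives of the solutions of `L` are expressed by those of order below `ord L`. -/
theorem exists_iterate_deriv_eq_sum (L : DiffOp K) (hL : L ≠ 0) (i : ℕ) : ∃ r : Fin L.ord → K,
    ∀ (F : Type u) [CommRing F] [Algebra K F] [Differential F] [DifferentialAlgebra K F] (f : F),
      L • f = 0 → (derivHom F)^[i] f = ∑ a, r a • (derivHom F)^[a] f := by
  obtain ⟨Q, R, h, hR⟩ := exists_eq_mul_add L hL ⟨monomial i 1⟩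
  -- The coefficients of the remainder of D ^ i modulo L. They are chosen before the extension F,
  -- which the minimality of the symmetric product over all extensions requires later.
  refine ⟨fun a => R.toPoly.coeff a, fun F _ _ _ _ f hf => ?_⟩
  rw [← smul_eq_sum R hR, ← one_smul K ((derivHom F)^[i] f), ← monomial_smul, h, add_smul,
    mul_smul, hf, smul_zero, zero_add]

end Division

/-! ### Wronskian arguments -/

section Independence

/-- The Wronskian criterion: a shortest F-linear relation among the sequences (y, y′, y″, …),
normalised to have a coefficient 1, becomes shorter after differentiation. So its coefficients are
constants, and it is a relation over C. -/
theorem linearIndependent_iterate_deriv {C F ι : Type*} [Field C] [Field F] [Algebra C F]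
    [Differential F] [Differential.ContainConstants C F] {y : ι → F}
    (hy : LinearIndependent C y) :
    LinearIndependent F fun j (i : ℕ) => (derivHom F)^[i] (y j) := by
  classical
  rw [linearIndependent_iff']
  intro s
  induction s using Finset.induction_on with
  | empty => simp
  | insert a s ha ih =>
    intro c hc
    have hc' : ∀ i : ℕ, ∑ j ∈ insert a s, c j * (derivHom F)^[i] (y j) = 0 := fun i => by
      simpa [Finset.sum_apply] using congrFun hc i
    have hca : c a = 0 := by
      by_contra hne
      have h1 : ∀ i : ℕ, ∑ j ∈ insert a s, (c j / c a) * (derivHom F)^[i] (y j) = 0 := by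
        intro i
        have : ∑ j ∈ insert a s, (c j / c a) * (derivHom F)^[i] (y j)
            = (c a)⁻¹ * ∑ j ∈ insert a s, c j * (derivHom F)^[i] (y j) := by
          rw [Finset.mul_sum]
          exact Finset.sum_congr rfl fun j _ => by ring
        rw [this, hc' i, mul_zero]
      -- The derivative of the relation at index i, minus the relation at index i + 1.
      have h2 : ∀ i : ℕ, ∑ j ∈ insert a s, (c j / c a)′ * (derivHom F)^[i] (y j) = 0 := by
        intro i
        have h := congrArg (fun z => z′) (h1 i)
        simp only [map_sum, Derivation.leibniz, smul_eq_mul, Finset.sum_add_distrib, map_zero,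
          ← derivHom_apply ((derivHom F)^[i] _), ← Function.iterate_succ_apply'] at h
        rw [h1 (i + 1), zero_add] at h
        rw [← h]
        exact Finset.sum_congr rfl fun j _ => mul_comm _ _
      -- The coefficient at `a` is 1, so its derivative drops out and the induction hypothesis for
      -- `s` applies.
      have h3 : ∀ j ∈ s, (c j / c a)′ = 0 := by
        refine ih (fun j => (c j / c a)′) (funext fun i => ?_)
        have h := h2 i
        rw [Finset.sum_insert ha, div_self hne, Derivation.map_one_eq_zero, zero_mul,
          zero_add] at h
        simpa [Finset.sum_apply] using h
      have h4 : ∀ j ∈ insert a s, ∃ d : C, algebraMap C F d = c j / c a := by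
        intro j hj
        refine mem_range_of_deriv_eq_zero C ?_
        obtain rfl | hj := Finset.mem_insert.mp hj
        · rw [div_self hne, Derivation.map_one_eq_zero]
        · exact h3 j hj
      choose! d hd using h4
      have h5 : ∑ j ∈ insert a s, d j • y j = 0 := by
        rw [← h1 0]
        exact Finset.sum_congr rfl fun j hj => by
          rw [Algebra.smul_def, hd j hj, Function.iterate_zero_apply]
      have h6 := linearIndependent_iff'.mp hy _ d h5 a (Finset.mem_insert_self a s)
      have h7 := hd a (Finset.mem_insert_self a s)
      rw [h6, map_zero, div_self hne] at h7
      exact zero_ne_one h7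
    intro j hj
    obtain rfl | hj := Finset.mem_insert.mp hj
    · exact hca
    · refine ih c ?_ j hj
      rw [Finset.sum_insert ha, hca, zero_smul, zero_add] at hc
      exact hc

variable {C K : Type*} {F : Type*} [Field C] [Field K] [Differential K] [Field F] [Algebra C F]
  [Algebra K F] [Differential F] [DifferentialAlgebra K F] [Differential.ContainConstants C F]

/-- For solutions of L the whole sequence of derivatives is a fixed F-linear image of its first ord
L terms, so a relation among the truncated vectors would extend to the sequences. -/
theorem linearIndependent_deriv_lt_ord {L : DiffOp K} (hL : L ≠ 0) {ι : Type*} {y : ι → F}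
    (hy : LinearIndependent C y) (hs : ∀ j, L • y j = 0) :
    LinearIndependent F fun j (a : Fin L.ord) => (derivHom F)^[a] (y j) := by
  choose r hr using exists_iterate_deriv_eq_sum L hL
  let ρ : (Fin L.ord → F) →ₗ[F] (ℕ → F) :=
    LinearMap.pi fun i => ∑ a, algebraMap K F (r i a) • LinearMap.proj a
  refine LinearIndependent.of_comp ρ ?_
  convert linearIndependent_iterate_deriv hy using 1
  funext j i
  rw [hr i F (y j) (hs j)]
  simp [ρ, Algebra.smul_def, LinearMap.sum_apply]

/-- A solution of `L` is a combination of any `ord L` independent solutions. -/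
theorem mem_span_of_linearIndependent {L : DiffOp K} (hL : L ≠ 0) {y : Fin L.ord → F}
    (hy : LinearIndependent C y) (hs : ∀ j, L • y j = 0) {z : F} (hz : L • z = 0) :
    z ∈ Submodule.span C (Set.range y) := by
  by_contra hmem
  -- Otherwise there would be ord L + 1 independent vectors in F ^ (ord L).
  have h := linearIndependent_deriv_lt_ord hL (linearIndependent_finCons.mpr ⟨hy, hmem⟩)
    (Fin.cases hz hs)
  have := h.fintype_card_le_finrank
  simp at this

/-- No nonzero linear form in the derivatives of order below `n` vanishes on `S`. -/
def Nondegenerate (n : ℕ) (S : Set F) : Prop :=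
  ∀ c : Fin n → F, (∀ f ∈ S, ∑ a, c a * (derivHom F)^[a] f = 0) → c = 0

/-- The ord L vectors of derivatives are independent in a space of dimension ord L, so they span it,
and a linear form that vanishes on them is zero. -/
theorem nondegenerate_of_linearIndependent {L : DiffOp K} (hL : L ≠ 0) {y : Fin L.ord → F}
    (hy : LinearIndependent C y) (hs : ∀ j, L • y j = 0) :
    Nondegenerate L.ord {f : F | L • f = 0} := by
  intro c hc
  have h := (linearIndependent_deriv_lt_ord hL hy hs).span_eq_top_of_card_eq_finrank' (by simp)
  let φ : (Fin L.ord → F) →ₗ[F] F := ∑ a, c a • LinearMap.proj a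
  have hφ : φ = 0 := by
    refine LinearMap.ext_on_range h fun j => ?_
    simpa [φ, LinearMap.sum_apply] using hc (y j) (hs j)
  funext a
  simpa [φ, LinearMap.sum_apply, Pi.single_apply] using LinearMap.congr_fun hφ (Pi.single a 1)

end Independence

end DiffOp

/-! ### Products of solutions -/

namespace DiffOp

section Products

variable {K : Type u} [Field K] [Differential K]

/-- The coefficients depend only on M, L and i. Whether an operator annihilates all products is
thereby governed by linear relations over K. -/
theorem exists_iterate_deriv_mul_eq_sum (M L : DiffOp K) (hM : M ≠ 0) (hL : L ≠ 0) (i : ℕ) :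
    ∃ r : Fin M.ord → Fin L.ord → K, ∀ (F : Type u) [Field F] [Algebra K F] [Differential F]
      [DifferentialAlgebra K F] (f g : F), M • f = 0 → L • g = 0 →
      (derivHom F)^[i] (f * g)
        = ∑ a, ∑ b, r a b • ((derivHom F)^[a] f * (derivHom F)^[b] g) := by
  choose p hp using exists_iterate_deriv_eq_sum.{u} M hM
  choose q hq using exists_iterate_deriv_eq_sum.{u} L hL
  induction i with
  | zero =>
    -- Even f and g themselves are reduced: an operator of order 0 leaves no index 0 available.
    refine ⟨fun a b => p 0 a * q 0 b, fun F _ _ _ _ f g hf hg => ?_⟩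
    have h1 := hp 0 F f hf
    have h2 := hq 0 F g hg
    rw [Function.iterate_zero_apply] at h1 h2
    rw [Function.iterate_zero_apply]
    conv_lhs => rw [h1, h2]
    rw [Finset.sum_mul_sum]
    exact Finset.sum_congr rfl fun a _ => Finset.sum_congr rfl fun b _ => smul_mul_smul_comm ..
  | succ i ih =>
    obtain ⟨r, hr⟩ := ih
    -- The Leibniz rule, with the derivatives of orders a + 1 and b + 1 reduced modulo M and L.
    refine ⟨fun a b => (r a b)′ + ∑ a', r a' b * p (a' + 1) a + ∑ b', r a b' * q (b' + 1) b,
      fun F _ _ _ _ f g hf hg => ?_⟩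
    rw [Function.iterate_succ_apply', hr F f g hf hg, derivHom_apply]
    have hterm : ∀ a b, (r a b • ((derivHom F)^[a] f * (derivHom F)^[b] g))′
        = (r a b)′ • ((derivHom F)^[a] f * (derivHom F)^[b] g)
          + ∑ a' : Fin M.ord, (r a b * p (a + 1) a') • ((derivHom F)^[a'] f * (derivHom F)^[b] g)
          + ∑ b' : Fin L.ord,
            (r a b * q (b + 1) b') • ((derivHom F)^[a] f * (derivHom F)^[b'] g) := by
      intro a b
      have h1 := hp (a + 1) F f hf
      have h2 := hq (b + 1) F g hg
      rw [Function.iterate_succ_apply', derivHom_apply] at h1 h2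
      rw [deriv_smul, Derivation.leibniz, h1, h2, smul_eq_mul, smul_eq_mul, Finset.mul_sum,
        Finset.mul_sum, smul_add, Finset.smul_sum, Finset.smul_sum, add_assoc,
        add_comm (∑ _, _) (∑ _, _)]
      congr 2
      · exact Finset.sum_congr rfl fun a' _ => by
          rw [mul_smul, mul_smul_comm, mul_comm ((derivHom F)^[b] g)]
      · exact Finset.sum_congr rfl fun b' _ => by rw [mul_smul, mul_smul_comm]
    simp only [map_sum, hterm, Finset.sum_add_distrib, add_smul, Finset.sum_smul]
    congr 1
    · congr 1
      rw [Finset.sum_congr rfl fun a _ => Finset.sum_comm, Finset.sum_comm]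
      rw [Finset.sum_congr rfl fun a _ => Finset.sum_comm]
    · exact Finset.sum_congr rfl fun a _ => Finset.sum_comm

variable {F : Type u} [Field F] [Algebra K F] [Differential F] [DifferentialAlgebra K F]

open scoped Pointwise

/-- Nondegeneracy passes from two operators to their symmetric product. -/
theorem Nondegenerate.mul_symProd {M L : DiffOp K} (hM : M ≠ 0) (hL : L ≠ 0) {S T : Set F}
    (hS : Nondegenerate M.ord S) (hT : Nondegenerate L.ord T) (hMS : ∀ f ∈ S, M • f = 0)
    (hLT : ∀ g ∈ T, L • g = 0) : Nondegenerate (symProd M L).ord (S * T) := by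
  obtain ⟨-, -, hmin⟩ := symProd_spec M L hM hL
  choose r hr using exists_iterate_deriv_mul_eq_sum M L hM hL
  intro c hc
  -- A linear form vanishing on the products is a bilinear form in the derivatives of f and g.
  -- Nondegeneracy of `S` with g fixed, and then of `T`, makes all its coefficients zero.
  have hrel : ∀ a b, ∑ i : Fin (symProd M L).ord, r i a b • c i = 0 := by
    intro a b
    refine congrFun (hT (fun b => ∑ i : Fin (symProd M L).ord, r i a b • c i) fun g hg => ?_) b
    refine congrFun (hS (fun a => ∑ b, (∑ i : Fin (symProd M L).ord, r i a b • c i)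
      * (derivHom F)^[b] g) fun f hf => ?_) a
    have h := hc _ (Set.mul_mem_mul hf hg)
    simp only [hr _ F f g (hMS f hf) (hLT g hg), Finset.mul_sum] at h
    rw [← h, Finset.sum_comm]
    refine Finset.sum_congr rfl fun a _ => ?_
    rw [Finset.sum_mul, Finset.sum_comm]
    refine Finset.sum_congr rfl fun b _ => ?_
    rw [Finset.sum_mul, Finset.sum_mul]
    refine Finset.sum_congr rfl fun i _ => ?_
    simp only [Algebra.smul_def]
    ring
  by_contra hne
  obtain ⟨i₀, hi₀⟩ := Function.ne_iff.mp hne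
  -- The relations have coefficients in K, so a K-linear functional on F turns the solution `c` into
  -- a nonzero one over K. That is an operator of order below the symmetric product which
  -- annihilates products in every extension, against minimality.
  obtain ⟨φ, hφ⟩ := Module.Projective.exists_dual_ne_zero K hi₀
  let N : DiffOp K := ⟨∑ i : Fin (symProd M L).ord, monomial i (φ (c i))⟩
  have hcoeff : ∀ i : Fin (symProd M L).ord, N.toPoly.coeff i = φ (c i) := by
    intro i
    simp [N, coeff_monomial, Fin.val_inj]
  have hdeg : N.toPoly.degree < (symProd M L).ord := by
    rw [degree_lt_iff_coeff_zero]
    intro m hm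
    simp only [N, Polynomial.finsetSum_coeff, coeff_monomial]
    exact Finset.sum_eq_zero fun i _ => if_neg (by omega)
  have hN : N ≠ 0 := by
    intro h
    apply hφ
    rw [← hcoeff, h, toPoly_zero, coeff_zero]
  obtain ⟨a, hmon, hord⟩ := exists_monic_smul N hN
  have hle := hmin _ hmon <| AnnihilatesProducts.const_mul (fun E _ _ _ _ f g hf hg => ?_) a
  · rw [hord] at hle
    refine hle.not_gt ?_
    exact (natDegree_lt_iff_degree_lt fun h => hN (DiffOp.ext h)).mpr hdeg
  · rw [smul_eq_sum N hdeg]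
    simp only [hcoeff, hr _ E f g hf hg, Finset.smul_sum]
    rw [Finset.sum_comm]
    refine Finset.sum_eq_zero fun a _ => ?_
    rw [Finset.sum_comm]
    refine Finset.sum_eq_zero fun b _ => ?_
    rw [Finset.sum_congr rfl fun i _ => smul_smul _ _ _, ← Finset.sum_smul]
    have h := congrArg φ (hrel a b)
    rw [map_sum, map_zero] at h
    rw [show ∑ i, φ (c i) * r i a b = 0 by
      rw [← h]
      exact Finset.sum_congr rfl fun i _ => by rw [map_smul, smul_eq_mul, mul_comm], zero_smul]

/-! ### Symmetric powers. -/

theorem symPow_succ_ne_zero {L : DiffOp K} (hL : L ≠ 0) (s : ℕ) : symPow L (s + 1) ≠ 0 := by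
  induction s with
  | zero => exact hL
  | succ s ih =>
    intro h
    have hm := (symProd_spec _ L ih hL).1
    rw [show symProd (symPow L (s + 1)) L = 0 from h] at hm
    exact hm.ne_zero rfl

/-- Products of `s + 1` solutions of `L` are solutions of the symmetric power. -/
theorem symPow_smul_eq_zero {L : DiffOp K} (hL : L ≠ 0) (s : ℕ) {S : Set F}
    (hS : ∀ f ∈ S, L • f = 0) : ∀ h ∈ S ^ (s + 1), symPow L (s + 1) • h = 0 := by
  induction s with
  | zero => rwa [zero_add, pow_one]
  | succ s ih =>
    intro h hh
    rw [pow_succ] at hh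
    obtain ⟨f, hf, g, hg, rfl⟩ := Set.mem_mul.mp hh
    exact (symProd_spec _ L (symPow_succ_ne_zero hL s) hL).2.1 F f g (ih f hf) (hS g hg)

/-- This plays the role of the statement that the products of solutions of L span the solution space
of its symmetric power. -/
theorem Nondegenerate.symPow {L : DiffOp K} (hL : L ≠ 0) (s : ℕ) {S : Set F}
    (hS : ∀ f ∈ S, L • f = 0) (hn : Nondegenerate L.ord S) :
    Nondegenerate (symPow L (s + 1)).ord (S ^ (s + 1)) := by
  induction s with
  | zero => rwa [zero_add, pow_one]
  | succ s ih =>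
    rw [pow_succ]
    exact ih.mul_symProd (symPow_succ_ne_zero hL s) hL hn (symPow_smul_eq_zero hL s hS) hS

/-- An operator that annihilates a nondegenerate set of solutions of `M` is a multiple of `M`. -/
theorem Nondegenerate.mem_span {M P : DiffOp K} (hM : M ≠ 0) {S : Set F}
    (hn : Nondegenerate M.ord S) (hS : ∀ f ∈ S, M • f = 0) (hP : ∀ f ∈ S, P • f = 0) :
    P ∈ Submodule.span (DiffOp K) {M} := by
  obtain ⟨Q, R, rfl, hR⟩ := exists_eq_mul_add M hM P
  -- The remainder modulo M also annihilates `S`. Its order is below that of M, so its coefficients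
  -- form a linear form to which nondegeneracy applies.
  have h := hn (fun a => algebraMap K F (R.toPoly.coeff a)) fun f hf => by
    have h := hP f hf
    rw [add_smul, mul_smul, hS f hf, smul_zero, zero_add, smul_eq_sum R hR] at h
    simpa only [Algebra.smul_def] using h
  have hR0 : R = 0 := by
    ext i
    rw [toPoly_zero, coeff_zero]
    by_cases hi : i < M.ord
    · exact (map_eq_zero (algebraMap K F)).mp (congrFun h ⟨i, hi⟩)
    · exact (degree_lt_iff_coeff_zero _ _).mp hR i (not_lt.mp hi)
  rw [hR0, add_zero]
  exact Submodule.mem_span_singleton.mpr ⟨Q, rfl⟩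

end Products

end DiffOp

/-! ### Puiseux series and integral series -/

namespace GenSeries

open scoped OnePoint

variable {C : Type u} [Field C] {ξ : OnePoint C}

theorem exists_of_coeff_mul_ne_zero {f g : GenSeries C ξ} {α : ℚ} (h : (f * g).coeff α ≠ 0) :
    ∃ β γ, f.coeff β ≠ 0 ∧ g.coeff γ ≠ 0 ∧ β + γ = α :=
  Set.mem_add.mp (HahnSeries.support_mul_subset (x := (f : HahnSeries ℚ C)) h) |>.imp
    fun _ ⟨h1, γ, h2, h3⟩ => ⟨γ, h1, h2, h3⟩

theorem IsPuiseux.mul {f g : GenSeries C ξ} (hf : f.IsPuiseux) (hg : g.IsPuiseux) :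
    (f * g).IsPuiseux := by
  obtain ⟨q, hq, hf⟩ := hf
  obtain ⟨r, hr, hg⟩ := hg
  refine ⟨q * r, Nat.mul_pos hq hr, fun α h => ?_⟩
  have hq' : (q : ℚ) ≠ 0 := by exact_mod_cast hq.ne'
  have hr' : (r : ℚ) ≠ 0 := by exact_mod_cast hr.ne'
  obtain ⟨β, γ, hβ, hγ, rfl⟩ := exists_of_coeff_mul_ne_zero h
  obtain ⟨m, rfl⟩ := hf β hβ
  obtain ⟨n, rfl⟩ := hg γ hγ
  refine ⟨m * r + n * q, ?_⟩
  push_cast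
  field_simp

open scoped Pointwise in
theorem isPuiseux_of_mem_pow {ξ : OnePoint C} {S : Set (GenSeries C ξ)} (hS : ∀ f ∈ S, f.IsPuiseux)
    (s : ℕ) : ∀ f ∈ S ^ (s + 1), f.IsPuiseux := by
  induction s with
  | zero => rwa [zero_add, pow_one]
  | succ s ih =>
    intro h hh
    rw [pow_succ] at hh
    obtain ⟨f, hf, g, hg, rfl⟩ := Set.mem_mul.mp hh
    exact (ih f hf).mul (hS g hg)

theorem IsIntegral.mul {f g : GenSeries C ξ} (hf : f.IsIntegral) (hg : g.IsIntegral) :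
    (f * g).IsIntegral := by
  intro α hα
  by_contra h
  obtain ⟨β, γ, hβ, hγ, rfl⟩ := exists_of_coeff_mul_ne_zero h
  have h1 : 0 ≤ β := not_lt.mp fun h => hβ (hf β h)
  have h2 : 0 ≤ γ := not_lt.mp fun h => hγ (hg γ h)
  linarith

/-! ### Integral series and rational functions without poles. -/

theorem coeff_monomial (α β : ℚ) (c : C) :
    (monomial ξ α c).coeff β = if β = α then c else 0 := by
  split_ifs with h
  · rw [h]
    exact HahnSeries.coeff_single_same α c
  · exact HahnSeries.coeff_single_of_ne h

theorem coeff_algebraMap (c : C) (α : ℚ) :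
    (algebraMap C (GenSeries C ξ) c).coeff α = if α = 0 then c else 0 := by
  rw [algebraMap_eq, coeff_monomial]

/-- The ring of integral series. -/
def integralSubring (ξ : OnePoint C) : Subring (GenSeries C ξ) where
  carrier := {f | f.IsIntegral}
  mul_mem' := IsIntegral.mul
  one_mem' := fun α hα => by
    rw [← monomial_zero_one ξ, coeff_monomial, if_neg hα.ne]
  add_mem' := fun hf hg α hα => by rw [coeff_add, hf α hα, hg α hα, add_zero]
  zero_mem' := fun α _ => coeff_zero α
  neg_mem' := fun {f} hf α hα => by
    change -(f.coeff α) = 0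
    rw [hf α hα, neg_zero]

/-- Two nonnegative exponents have sum 0 only if both are 0. So evaluation at t = 0 is
multiplicative on integral series. -/
theorem IsIntegral.coeff_zero_mul {f g : GenSeries C ξ} (hf : f.IsIntegral) (hg : g.IsIntegral) :
    (f * g).coeff 0 = f.coeff 0 * g.coeff 0 := by
  refine (HahnSeries.coeff_mul (x := (f : HahnSeries ℚ C)) (y := g) (a := 0)).trans ?_
  refine Finset.sum_eq_single (0, 0) (fun p hp hne => ?_) fun h => ?_
  · obtain ⟨h1, h2, h3⟩ := Finset.mem_antidiagonal.mp hp
    have h4 : 0 ≤ p.1 := not_lt.mp fun h => h1 (hf _ h)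
    have h5 : 0 ≤ p.2 := not_lt.mp fun h => h2 (hg _ h)
    exact absurd (Prod.ext (by dsimp; linarith) (by dsimp; linarith)) hne
  · by_contra h0
    exact h (Finset.mem_antidiagonal.mpr
      ⟨left_ne_zero_of_mul h0, right_ne_zero_of_mul h0, add_zero 0⟩)

theorem aeval_expandX_coe (c : C) (p : C[X]) :
    (aeval (expandX (c : OnePoint C)) p).IsIntegral ∧
      (aeval (expandX (c : OnePoint C)) p).coeff 0 = p.eval c := by
  have hC : ∀ a : C, (algebraMap C (GenSeries C (c : OnePoint C)) a).IsIntegral := fun a α hα => by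
    rw [coeff_algebraMap, if_neg hα.ne]
  have hX : (expandX (c : OnePoint C)).IsIntegral := by
    refine (integralSubring _).add_mem (hC c) fun α hα => ?_
    rw [coeff_monomial, if_neg (by linarith)]
  have hX0 : (expandX (c : OnePoint C)).coeff 0 = c := by
    change (algebraMap C (GenSeries C c) c + monomial c 1 1).coeff 0 = c
    rw [coeff_add, coeff_algebraMap, coeff_monomial]
    simp
  induction p using Polynomial.induction_on with
  | C a => rw [aeval_C, eval_C]; exact ⟨hC a, by rw [coeff_algebraMap, if_pos rfl]⟩
  | add p q hp hq =>
    rw [map_add, eval_add, coeff_add, hp.2, hq.2]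
    exact ⟨(integralSubring _).add_mem hp.1 hq.1, rfl⟩
  | monomial n a h =>
    rw [pow_succ, ← mul_assoc, map_mul, eval_mul, aeval_X, eval_X]
    exact ⟨h.1.mul hX, by rw [h.1.coeff_zero_mul hX, h.2, hX0]⟩

/-- At infinity x is 1 / t, so the powers of x in a polynomial appear as poles in t, which
integrality there forbids. -/
theorem coeff_aeval_expandX_infty (p : C[X]) (n : ℕ) :
    (aeval (expandX (∞ : OnePoint C)) p).coeff (-n) = p.coeff n := by
  have hpow : ∀ k : ℕ, expandX (∞ : OnePoint C) ^ k = monomial ∞ (-k) 1 := by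
    intro k
    induction k with
    | zero => simp [monomial_zero_one]
    | succ k ih =>
      rw [pow_succ, ih]
      change monomial ∞ (-k) 1 * monomial ∞ (-1) 1 = _
      rw [monomial_mul]
      push_cast
      congr 1 <;> ring
  induction p using Polynomial.induction_on' with
  | add p q hp hq => rw [map_add, coeff_add, hp, hq, Polynomial.coeff_add]
  | monomial k a =>
    rw [aeval_monomial, hpow, algebraMap_eq, monomial_mul, coeff_monomial,
      Polynomial.coeff_monomial]
    simp [eq_comm]

/-- A rational function without poles on `C ∪ {∞}` is constant. -/
theorem mem_range_of_isIntegral [IsAlgClosed C] (f : RatFunc C)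
    (hf : ∀ ξ : OnePoint C, (algebraMap (RatFunc C) (GenSeries C ξ) f).IsIntegral) :
    f ∈ (algebraMap C (RatFunc C)).range := by
  -- At a root c of the denominator, the constant terms in f · denom = num give num(c) = 0, since f
  -- is integral there. This contradicts coprimality.
  have hden : f.denom.degree = 0 := by
    by_contra hdeg
    obtain ⟨c, hc⟩ := IsAlgClosed.exists_root f.denom hdeg
    have h1 : algebraMap (RatFunc C) (GenSeries C (c : OnePoint C)) f
        * aeval (expandX (c : OnePoint C)) f.denom = aeval (expandX (c : OnePoint C)) f.num := by
      rw [← ratExpand_poly, ← ratExpand_poly, ← algebraMap_ratFunc, ← algebraMap_ratFunc,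
        ← map_mul]
      congr 1
      nth_rw 1 [← RatFunc.num_div_denom f]
      exact div_mul_cancel₀ _ (RatFunc.algebraMap_ne_zero f.denom_ne_zero)
    have h2 := congrArg (fun g => g.coeff 0) h1
    simp only [(hf c).coeff_zero_mul (aeval_expandX_coe c _).1, (aeval_expandX_coe c _).2] at h2
    rw [hc.eq_zero, mul_zero] at h2
    obtain ⟨a, b, hab⟩ := RatFunc.isCoprime_num_denom f
    have h3 := congrArg (eval c) hab
    rw [eval_add, eval_mul, eval_mul, ← h2, hc.eq_zero, mul_zero, mul_zero, add_zero,
      eval_one] at h3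
    exact zero_ne_one h3
  have hden1 : f.denom = 1 := (RatFunc.monic_denom f).eq_one_of_isUnit
    (isUnit_iff_degree_eq_zero.mpr hden)
  have hfp : f = algebraMap C[X] (RatFunc C) f.num := by
    conv_lhs => rw [← RatFunc.num_div_denom f, hden1, map_one, div_one]
  -- Now f is a polynomial, and integrality at infinity kills its coefficients of positive degree.
  have hnum : f.num = Polynomial.C (f.num.coeff 0) := by
    ext n
    cases n with
    | zero => rw [coeff_C_zero]
    | succ n =>
      rw [coeff_C_succ, ← coeff_aeval_expandX_infty, ← ratExpand_poly, ← hfp]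
      exact hf ∞ _ (by push_cast; linarith [n.cast_nonneg (α := ℚ)])
  refine ⟨f.num.coeff 0, Eq.trans ?_ hfp.symm⟩
  conv_rhs => rw [hnum]
  rw [IsScalarTower.algebraMap_apply C C[X] (RatFunc C), Polynomial.algebraMap_eq]

/-! ### Constants of the series fields and of C(x). -/

variable [CharZero C]

instance : CharZero (GenSeries C ξ) :=
  charZero_of_injective_algebraMap (algebraMap C (GenSeries C ξ)).injective

instance : Differential.ContainConstants C (GenSeries C ξ) where
  mem_range_of_deriv_eq_zero {f} hf := by
    -- If this factor vanished, the derivation would be zero, but x′ = 1. So t d/dt kills f, and in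
    -- characteristic zero only the exponent 0 survives.
    have h0 : paramDeriv ξ * monomial ξ (-1) 1 ≠ 0 := by
      intro h
      have := deriv_expandX ξ
      rw [deriv_def, h, zero_mul] at this
      exact zero_ne_one this
    have h1 : eulerDeriv f = 0 := (mul_eq_zero.mp (deriv_def f ▸ hf)).resolve_left h0
    refine ⟨f.coeff 0, ext fun α => ?_⟩
    rw [coeff_algebraMap]
    split_ifs with h
    · rw [h]
    · have h2 : (α : C) * f.coeff α = 0 := congrArg (fun g => g.coeff α) h1
      exact ((mul_eq_zero.mp h2).resolve_left (by exact_mod_cast h)).symm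

end GenSeries

instance {C : Type u} [Field C] [CharZero C] : Differential.ContainConstants C (RatFunc C) where
  mem_range_of_deriv_eq_zero {f} hf := by
    obtain ⟨c, hc⟩ := mem_range_of_deriv_eq_zero C
      (x := algebraMap (RatFunc C) (GenSeries C OnePoint.infty) f)
      (by rw [deriv_algebraMap, hf, map_zero])
    refine ⟨c, (algebraMap (RatFunc C) (GenSeries C OnePoint.infty)).injective ?_⟩
    rw [← hc, ← IsScalarTower.algebraMap_apply]

/-! ### Algebraic solutions and pseudoconstants -/

section Main

variable {C : Type u} [Field C] [CharZero C]

/-- The zero operator has order 0 by convention, so a basis would make its solution space trivial;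
but 1 is a solution. -/
theorem HasPuiseuxBases.ne_zero {L : DiffOp (RatFunc C)} (hL : HasPuiseuxBases L) : L ≠ 0 := by
  rintro rfl
  obtain ⟨b⟩ := hL OnePoint.infty
  have : IsEmpty (Fin (0 : DiffOp (RatFunc C)).ord) := by
    rw [DiffOp.ord, DiffOp.toPoly_zero, natDegree_zero]
    infer_instance
  have hsub := b.repr.toEquiv.subsingleton
  have h1 : (1 : GenSeries C OnePoint.infty) ∈ puiseuxSolutions 0 OnePoint.infty := by
    refine ⟨zero_smul _ _, 1, one_pos, fun α h => ⟨0, ?_⟩⟩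
    by_contra hα
    rw [← GenSeries.monomial_zero_one, GenSeries.coeff_monomial, if_neg (by simpa using hα)] at h
    exact h rfl
  exact one_ne_zero (congrArg Subtype.val (Subsingleton.elim ⟨1, h1⟩ 0))

instance (ξ : OnePoint C) :
    DifferentialAlgebra (RatFunc C) (AlgebraicClosure (GenSeries C ξ)) :=
  DifferentialAlgebra.trans _ (GenSeries C ξ) _

theorem algebraMap_diffOp_smul {ξ : OnePoint C} (P : DiffOp (RatFunc C)) (f : GenSeries C ξ) :
    algebraMap (GenSeries C ξ) (AlgebraicClosure (GenSeries C ξ)) (P • f)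
      = P • algebraMap (GenSeries C ξ) (AlgebraicClosure (GenSeries C ξ)) f :=
  AlgHom.map_diffOp_smul
    (IsScalarTower.toAlgHom (RatFunc C) (GenSeries C ξ) (AlgebraicClosure (GenSeries C ξ)))
    (fun x => (deriv_algebraMap x).symm) P f

variable [IsAlgClosed C]

/-- Every algebraic function over the series at `ξ` that solves `L` is a Puiseux series. -/
theorem HasPuiseuxBases.exists_puiseuxSolution {L : DiffOp (RatFunc C)} (hL : HasPuiseuxBases L)
    (ξ : OnePoint C) {z : AlgebraicClosure (GenSeries C ξ)} (hz : L • z = 0) :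
    ∃ f ∈ puiseuxSolutions L ξ, algebraMap _ _ f = z := by
  have : Differential.ContainConstants C (AlgebraicClosure (GenSeries C ξ)) :=
    containConstants_of_isAlgebraic C (GenSeries C ξ) _
  obtain ⟨b⟩ := hL ξ
  let φ : GenSeries C ξ →ₗ[C] AlgebraicClosure (GenSeries C ξ) :=
    (IsScalarTower.toAlgHom C (GenSeries C ξ) (AlgebraicClosure (GenSeries C ξ))).toLinearMap
  have hφ : LinearMap.ker φ = ⊥ := LinearMap.ker_eq_bot.mpr
    (algebraMap (GenSeries C ξ) (AlgebraicClosure (GenSeries C ξ))).injective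
  have hli : LinearIndependent C fun j => φ (b j) :=
    (b.linearIndependent.map' _ (Submodule.ker_subtype _)).map' φ hφ
  have hsol : ∀ j, L • φ (b j) = 0 := fun j => by
    have h := algebraMap_diffOp_smul L (b j : GenSeries C ξ)
    rw [show L • (b j : GenSeries C ξ) = 0 from (b j).2.1, map_zero] at h
    exact h.symm
  -- The constants of the closure are still C, so the ord L Puiseux solutions already span all
  -- solutions there.
  have hmem := DiffOp.mem_span_of_linearIndependent hL.ne_zero hli hsol hz
  have hle : Submodule.span C (Set.range fun j => φ (b j)) ≤ (puiseuxSolutions L ξ).map φ :=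
    Submodule.span_le.mpr (by
      rintro _ ⟨j, rfl⟩
      exact Submodule.mem_map_of_mem (b j).2)
  exact hle hmem

/-- The Vieta formulas: the coefficients of a monic polynomial that splits lie in every subring
that contains its roots. -/
theorem coeff_mem_range_of_roots {R F : Type*} [CommRing R] [Field F] (i : R →+* F) {p : F[X]}
    (hm : p.Monic) (hp : p.Splits) (hr : ∀ z ∈ p.roots, z ∈ i.range) (n : ℕ) :
    p.coeff n ∈ i.range := by
  have h : p ∈ liftsRing i := by
    rw [hp.eq_prod_roots_of_monic hm]
    refine Subring.multiset_prod_mem _ _ fun q hq => ?_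
    obtain ⟨z, hz, rfl⟩ := Multiset.mem_map.mp hq
    obtain ⟨r, rfl⟩ := hr z hz
    exact ⟨X - Polynomial.C r, by simp⟩
  obtain ⟨q, rfl⟩ := h
  exact ⟨q.coeff n, by simp⟩

open scoped Pointwise

/-! ### Values of completely integral elements at algebraic solutions. -/

section Algebraic

variable {A : Type u} [Field A] [Algebra C A] [Algebra (RatFunc C) A]
  [IsScalarTower C (RatFunc C) A] [Algebra.IsAlgebraic (RatFunc C) A] [Differential A]
  [DifferentialAlgebra (RatFunc C) A]

/-- Completely integral elements take constant values at products of algebraic solutions. -/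
theorem deriv_smul_eq_zero_of_isCompletelyIntegral {L : DiffOp (RatFunc C)}
    (hL : HasPuiseuxBases L) (s : ℕ) {P : DiffOp (RatFunc C)}
    (hP : IsCompletelyIntegral (L := L.symPow (s + 1)) (Submodule.Quotient.mk P)) (h : A)
    (hh : h ∈ {f : A | L • f = 0} ^ (s + 1)) : (P • h)′ = 0 := by
  have hint : IsIntegral (RatFunc C) (P • h) := Algebra.IsIntegral.isIntegral _
  -- An element algebraic over the algebraically closed field C lies in C, and has derivative zero.
  suffices hc : ∀ i, (minpoly (RatFunc C) (P • h)).coeff i ∈ (algebraMap C (RatFunc C)).range by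
    obtain ⟨c, hc⟩ := mem_range_of_coeff_mem_range C (minpoly.ne_zero hint) hc (minpoly.aeval _ _)
    rw [← hc, IsScalarTower.algebraMap_apply C (RatFunc C) A, deriv_algebraMap,
      deriv_algebraMap_const, map_zero]
  refine fun i => GenSeries.mem_range_of_isIntegral _ fun ξ => ?_
  let ι := algebraMap (GenSeries C ξ) (AlgebraicClosure (GenSeries C ξ))
  have hroot : ∀ z ∈ ((minpoly (RatFunc C) (P • h)).map
      (algebraMap (RatFunc C) (AlgebraicClosure (GenSeries C ξ)))).roots,
      z ∈ (ι.comp (GenSeries.integralSubring ξ).subtype).range := by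
    intro z hz
    -- The roots of the minimal polynomial are the images of P • h under the embeddings of A into
    -- the closure of the series field.
    obtain ⟨σ, rfl⟩ : z ∈ Set.range fun σ : A →ₐ[RatFunc C] AlgebraicClosure (GenSeries C ξ) =>
        σ (P • h) := by
      rw [Algebra.IsAlgebraic.range_eval_eq_rootSet_minpoly, mem_rootSet', aeval_def,
        ← eval_map]
      exact mem_roots'.mp hz
    have hσ : ∀ Q : DiffOp (RatFunc C), ∀ f : A, σ (Q • f) = Q • σ f :=
      AlgHom.map_diffOp_smul σ (AlgHom.map_deriv_of_isAlgebraic σ)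
    have hsub : σ '' {f : A | L • f = 0} ⊆ ι '' (puiseuxSolutions L ξ : Set (GenSeries C ξ)) := by
      rintro _ ⟨f, hf, rfl⟩
      exact hL.exists_puiseuxSolution ξ (by
        rw [← hσ, show L • f = 0 from hf, map_zero])
    -- The conjugate σ(h) is a product of Puiseux solutions, so it is a Puiseux series and solves
    -- the symmetric power. This makes the integrality of [P] applicable to it.
    have hσh : σ h ∈ ι '' ((puiseuxSolutions L ξ : Set (GenSeries C ξ)) ^ (s + 1)) := by
      rw [Set.image_pow]
      refine Set.pow_subset_pow_left hsub ?_
      rw [← Set.image_pow]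
      exact Set.mem_image_of_mem σ hh
    obtain ⟨k, hk, hkh⟩ := hσh
    have hkL := DiffOp.symPow_smul_eq_zero hL.ne_zero s (fun f hf => hf.1) k hk
    have hkP := GenSeries.isPuiseux_of_mem_pow (fun f hf => hf.2) s k hk
    refine ⟨⟨P • k, hP ξ k hkL hkP⟩, ?_⟩
    change ι (P • k) = σ (P • h)
    rw [algebraMap_diffOp_smul, hσ, ← hkh]
  -- The coefficients are symmetric functions of integral roots, so they are integral at ξ.
  obtain ⟨⟨g, hg⟩, hgi⟩ := coeff_mem_range_of_roots _ ((minpoly.monic hint).map _)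
    (IsAlgClosed.splits _) hroot i
  rw [coeff_map, IsScalarTower.algebraMap_apply (RatFunc C) (GenSeries C ξ)] at hgi
  rwa [← ι.injective hgi]

/-- If a symmetric power of `L` has a pseudoconstant, then no algebraic extension of `C(x)` contains
`ord L` independent solutions. -/
theorem not_linearIndependent_of_hasPseudoconstant {L : DiffOp (RatFunc C)}
    (hL : HasPuiseuxBases L) (s : ℕ) (hpc : HasPseudoconstant (L.symPow (s + 1)))
    {y : Fin L.ord → A} (hy : ∀ j, L • y j = 0) : ¬ LinearIndependent C y := by
  intro hli
  have : Differential.ContainConstants C A := containConstants_of_isAlgebraic C (RatFunc C) A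
  obtain ⟨p, hp, hDp⟩ := hpc
  obtain ⟨P, rfl⟩ := Submodule.Quotient.mk_surjective _ p
  refine hDp ((Submodule.Quotient.mk_eq_zero _ (x := DiffOp.D * P)).mpr ?_)
  have hn := DiffOp.nondegenerate_of_linearIndependent hL.ne_zero hli hy
  -- It suffices that D P annihilates the products of s + 1 solutions, as these are nondegenerate
  -- for the symmetric power.
  refine (hn.symPow hL.ne_zero s (fun f hf => hf)).mem_span
    (DiffOp.symPow_succ_ne_zero hL.ne_zero s)
    (DiffOp.symPow_smul_eq_zero hL.ne_zero s (fun f hf => hf)) fun h hh => ?_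
  rw [mul_smul, DiffOp.D_smul]
  exact deriv_smul_eq_zero_of_isCompletelyIntegral hL s hp h hh

end Algebraic

/-- If all Puiseux solutions at ξ were algebraic, the algebraic closure of C(x) in the series field
would contain ord L independent solutions. -/
theorem exists_transcendental_of_hasPseudoconstant {L : DiffOp (RatFunc C)}
    (hL : HasPuiseuxBases L) (s : ℕ) (hpc : HasPseudoconstant (L.symPow (s + 1)))
    (ξ : OnePoint C) : ∃ f ∈ puiseuxSolutions L ξ, Transcendental (RatFunc C) f := by
  by_contra hne
  have halg : ∀ f ∈ puiseuxSolutions L ξ, IsAlgebraic (RatFunc C) f := fun f hf => by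
    by_contra h
    exact hne ⟨f, hf, h⟩
  obtain ⟨b⟩ := hL ξ
  let A := algebraicClosure (RatFunc C) (GenSeries C ξ)
  -- The derivation of A extends that of C(x). Since A is algebraic over C(x), its inclusion into
  -- the series field commutes with the derivations.
  let _ : Differential A := differentialOfSeparable (RatFunc C) A
  have : DifferentialAlgebra (RatFunc C) A := differentialAlgebra_of_separable (RatFunc C) A
  have hA : ∀ j, (b j : GenSeries C ξ) ∈ A := fun j =>
    mem_algebraicClosure_iff.mpr (halg _ (b j).2)
  refine not_linearIndependent_of_hasPseudoconstant hL s hpc (y := fun j => (⟨b j, hA j⟩ : A))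
    (fun j => ?_) ?_
  · refine A.val.injective ((AlgHom.map_diffOp_smul A.val
      (AlgHom.map_deriv_of_isAlgebraic A.val) L ⟨b j, hA j⟩).trans ?_)
    exact (b j).2.1.trans (map_zero A.val).symm
  · have hli : LinearIndependent C fun j => (b j : GenSeries C ξ) :=
      b.linearIndependent.map' (puiseuxSolutions L ξ).subtype (Submodule.ker_subtype _)
    exact LinearIndependent.of_comp (A.val.restrictScalars C).toLinearMap hli

end Main

theorem mainTheorem2 {C : Type u} [Field C] [IsAlgClosed C] [CharZero C]
    (L : DiffOp (RatFunc C)) (hL : HasPuiseuxBases L) (s : ℕ) (hs : 1 ≤ s)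
    (hpc : HasPseudoconstant (L.symPow s)) :
    ¬ HasOnlyAlgebraicSolutions L ∧
      ∀ ξ : OnePoint C, ∃ f ∈ puiseuxSolutions L ξ, Transcendental (RatFunc C) f := by
  -- Writing the exponent as s + 1 excludes the conventional value `D` of `symPow` at 0.
  obtain ⟨s, rfl⟩ := Nat.exists_eq_add_of_le' hs
  constructor
  · rintro ⟨E, _, _, _, _, _, _, _, ⟨b⟩⟩
    have hli : LinearIndependent C fun j => (b j : E) :=
      b.linearIndependent.map' (solutions L E).subtype (Submodule.ker_subtype _)
    exact not_linearIndependent_of_hasPseudoconstant hL s hpc (fun j => (b j).2) hli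
  · exact exists_transcendental_of_hasPseudoconstant hL s hpc
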